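/- All graphs are finite and simple. For distinct vertices $u,v$ of a graph $G$, let $\kappa_G(u,v)$ be the maximum number of pairwise internally disjoint $u$–$v$ paths in $G$, and let $\overline{\kappa}(G)$ be the average of $\kappa_G(u,v)$ over all unordered pairs of distinct vertices of $G$. Likewise, for distinct vertices $u,v$ of a digraph $D$, let $\kappa_D(u,v)$ be the maximum number of pairwise internally disjoint directed paths from $u$ to $v$ in $D$, and let $\overline{\kappa}(D)$ be the average of $\kappa_D(u,v)$ over all ordered pairs of distinct vertices of $D$. An orientation of $G$ is a digraph obtained by assigning a direction to every edge of $G$, and $\overline{\kappa}_{\max}(G)$ denotes the maximum of $\overline{\kappa}(D)$ over all orientations $D$ of $G$. The connectivity $\kappa(G)$ is the least number of vertices whose removal leaves a graph that is disconnected or has at most one vertex; $G$ is minimally $2$-connected if $\kappa(G)=2$ and $\kappa(G-e)<2$ for every edge $e$ of $G$. For every minimally $2$-connected graph $G$, $$\frac{4}{9}<\frac{\overline{\kappa}_{\max}(G)}{\overline{\kappa}(G)}<\frac{5}{8}.$$ -/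

import Mathlib

open Finset

/-- Two `u`–`v` paths, given by their lists of vertices, are internally disjoint if they have no
common vertex other than `u` and `v`. -/
def InternallyDisjoint {V : Type*} (u v : V) (p q : List V) : Prop :=
  ∀ x, x ∈ p → x ∈ q → x = u ∨ x = v

namespace SimpleGraph

/-- A finite set of (distinct) `u`–`v` paths of `G` that are pairwise internally disjoint. -/
def IsDisjointPathFamily {V : Type*} (G : SimpleGraph V) (u v : V)
    (S : Finset (G.Path u v)) : Prop :=
  ∀ p ∈ S, ∀ q ∈ S, p ≠ q → InternallyDisjoint u v p.1.support q.1.support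

/-- `κ_G(u,v)`: the maximum number of pairwise internally disjoint `u`–`v` paths in `G`
(used for `u ≠ v` in a finite graph, where the set of possible numbers is bounded). -/
noncomputable def pairConnectivity {V : Type*} (G : SimpleGraph V) (u v : V) : ℕ :=
  sSup {k | ∃ S : Finset (G.Path u v), G.IsDisjointPathFamily u v S ∧ #S = k}

theorem pairConnectivity_comm {V : Type*} (G : SimpleGraph V) (u v : V) :
    G.pairConnectivity u v = G.pairConnectivity v u := by
  have key : ∀ a b : V,
      {k | ∃ S : Finset (G.Path a b), G.IsDisjointPathFamily a b S ∧ #S = k} ⊆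
        {k | ∃ S : Finset (G.Path b a), G.IsDisjointPathFamily b a S ∧ #S = k} := by
    rintro a b k ⟨S, hS, rfl⟩
    have hinj : Function.Injective (Path.reverse : G.Path a b → G.Path b a) := by
      intro p q h
      have h' := congrArg (fun r : G.Path b a => r.1.reverse) h
      exact Subtype.ext (by simpa [Path.reverse] using h')
    refine ⟨S.map ⟨Path.reverse, hinj⟩, ?_, by simp⟩
    intro p hp q hq hpq x hxp hxq
    obtain ⟨p', hp', rfl⟩ := Finset.mem_map.1 hp
    obtain ⟨q', hq', rfl⟩ := Finset.mem_map.1 hq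
    have hne : p' ≠ q' := fun h => hpq (by rw [h])
    have h1 : x ∈ p'.1.support := by simpa [Path.reverse] using hxp
    have h2 : x ∈ q'.1.support := by simpa [Path.reverse] using hxq
    exact (hS p' hp' q' hq' hne x h1 h2).symm
  exact congrArg sSup (Set.Subset.antisymm (key u v) (key v u))

/-- The average connectivity `κ̄(G)`: the average of `κ_G(u,v)` over all unordered pairs of distinct
vertices, i.e. over all elements `s(u,v)` of `Sym2 V` off the diagonal. -/
noncomputable def averageConnectivity {V : Type*} [Fintype V] [DecidableEq V]
    (G : SimpleGraph V) : ℝ :=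
  (∑ e : Sym2 V with ¬ e.IsDiag,
      ((Sym2.lift ⟨G.pairConnectivity, G.pairConnectivity_comm⟩ e : ℕ) : ℝ)) /
    ((Fintype.card V).choose 2 : ℝ)

/-- The connectivity `κ(G)` of a finite graph: the least number of vertices whose removal leaves a
graph that is disconnected or has at most one vertex. -/
noncomputable def connectivity {V : Type*} (G : SimpleGraph V) : ℕ :=
  sInf {k | ∃ S : Finset V, #S = k ∧
    (¬ (G.induce ((S : Set V)ᶜ)).Preconnected ∨ ((S : Set V)ᶜ).Subsingleton)}

/-- `G` is minimally `k`-connected: `κ(G) = k`, and `κ(G - e) < k` for every edge `e` of `G`. -/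
def IsMinimallyConnected {V : Type*} (G : SimpleGraph V) (k : ℕ) : Prop :=
  G.connectivity = k ∧ ∀ e ∈ G.edgeSet, (G.deleteEdges {e}).connectivity < k

end SimpleGraph

namespace Digraph

/-- The list of vertices `p` is a directed path of `D` from `u` to `v`. -/
def IsPath {V : Type*} (D : Digraph V) (u v : V) (p : List V) : Prop :=
  p.head? = some u ∧ p.getLast? = some v ∧ p.IsChain D.Adj ∧ p.Nodup

/-- A finite set of (distinct) directed `u`–`v` paths of `D` that are pairwise internally
disjoint. -/
def IsDisjointPathFamily {V : Type*} (D : Digraph V) (u v : V) (S : Finset (List V)) : Prop :=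
  (∀ p ∈ S, D.IsPath u v p) ∧ ∀ p ∈ S, ∀ q ∈ S, p ≠ q → InternallyDisjoint u v p q

/-- `κ_D(u,v)`: the maximum number of pairwise internally disjoint directed `u`–`v` paths in `D`
(used for `u ≠ v` in a finite digraph, where the set of possible numbers is bounded). -/
noncomputable def pairConnectivity {V : Type*} (D : Digraph V) (u v : V) : ℕ :=
  sSup {k | ∃ S : Finset (List V), D.IsDisjointPathFamily u v S ∧ #S = k}

/-- The average connectivity `κ̄(D)`: the average of `κ_D(u,v)` over all ordered pairs of distinct
vertices. -/
noncomputable def averageConnectivity {V : Type*} [Fintype V] [DecidableEq V]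
    (D : Digraph V) : ℝ :=
  (∑ e ∈ (univ : Finset V).offDiag, (D.pairConnectivity e.1 e.2 : ℝ)) /
    ((Fintype.card V : ℝ) * ((Fintype.card V : ℝ) - 1))

/-- `D` is an orientation of `G`: every arc of `D` is an edge of `G`, and every edge of `G` is an
arc of `D` in exactly one of its two directions. -/
def IsOrientation {V : Type*} (D : Digraph V) (G : SimpleGraph V) : Prop :=
  (∀ u v, D.Adj u v → G.Adj u v) ∧ ∀ u v, G.Adj u v → Xor (D.Adj u v) (D.Adj v u)

end Digraph

namespace SimpleGraph

/-- `κ̄_max(G)`: the maximum of `κ̄(D)` over all orientations `D` of `G`. -/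
noncomputable def maxAverageConnectivity {V : Type*} [Fintype V] [DecidableEq V]
    (G : SimpleGraph V) : ℝ :=
  sSup {x | ∃ D : Digraph V, D.IsOrientation G ∧ D.averageConnectivity = x}

/-- The supremum in `maxAverageConnectivity` is a maximum. -/
theorem isGreatest_maxAverageConnectivity {V : Type*} [Fintype V] [DecidableEq V]
    (G : SimpleGraph V) :
    IsGreatest {x | ∃ D : Digraph V, D.IsOrientation G ∧ D.averageConnectivity = x}
      G.maxAverageConnectivity := by
  have hfin : {x : ℝ | ∃ D : Digraph V, D.IsOrientation G ∧ D.averageConnectivity = x}.Finite :=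
    (Set.finite_range (Digraph.averageConnectivity (V := V))).subset
      (by rintro x ⟨D, -, rfl⟩; exact ⟨D, rfl⟩)
  have hne : {x : ℝ | ∃ D : Digraph V, D.IsOrientation G ∧ D.averageConnectivity = x}.Nonempty := by
    refine ⟨_, ⟨fun u v => G.Adj u v ∧ WellOrderingRel u v⟩, ⟨fun u v h => h.1, ?_⟩, rfl⟩
    intro u v h
    rcases trichotomous_of (WellOrderingRel (α := V)) u v with huv | huv | huv
    · exact Or.inl ⟨⟨h, huv⟩, fun hc => asymm_of WellOrderingRel huv hc.2⟩
    · exact absurd huv h.ne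
    · exact Or.inr ⟨⟨h.symm, huv⟩, fun hc => asymm_of WellOrderingRel huv hc.2⟩
  exact ⟨hne.csSup_mem hfin, fun x hx => le_csSup hfin.bddAbove hx⟩

end SimpleGraph

/-! The ratio is squeezed between separate bounds `2 ≤ κ̄(G) < 9/4` and `1 ≤ κ̄_max(G) < 5/4`. The
lower bounds are classical: without a cut vertex any two vertices are joined by two internally
disjoint paths, and Robbins' theorem supplies a strong orientation.

For the upper bounds, let `n` be the order of `G`, `b` the number of vertices of degree at least
three, `c` the number of components they induce, and `X` the sum of `deg v - 2` over them. By
minimality every edge `xy` comes with a vertex `z` such that `xy` is a bridge of `G - z`. Playing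
such cuts against each other shows that the vertices of degree at least three induce a forest
(Mader), and counting edges then gives `X ≤ 2(n - b) - 2c`.

Call `κ(u,v) - 2` the excess of a pair. Two vertices in one tree of the forest have excess zero,
since a vertex and an edge separate them. From a fixed `u`, the excesses into any other tree add up
to at most `deg u - 2`: the vertices of that tree with positive excess are separated from one
another by bridges of `G - u`, so they must share the edges at `u`. Hence the total excess over
ordered pairs is at most `(c - 1) X ≤ (c - 1)(2n - 4c) ≤ (n - 2)² / 4`, which is less than `n(n - 1)
/ 4`.

In an orientation, `κ(u,v) + κ(v,u)` is at most the degree in `G` of either end. This gives twice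
the total connectivity at most `2n(n - 1) + (b - 1) X`, and `(b - 1) X ≤ (b - 1)(2n - 2b - 2) ≤ (n -
2)² / 2` finishes in the same way. -/

namespace SimpleGraph

/-! ### Cut vertices, and the edge–vertex cuts forced by minimality. -/

variable {V : Type*} {G : SimpleGraph V}

/-- No vertex of `G` is a cut vertex: for every vertex `c`, every nontrivial bipartition of the
remaining vertices is crossed by an edge. -/
def NoCutVertex (G : SimpleGraph V) : Prop :=
  ∀ (c : V) (C : Set V), c ∉ C → C.Nonempty → (∃ z, z ∉ C ∧ z ≠ c) →
    ∃ p ∈ C, ∃ q, q ∉ C ∧ q ≠ c ∧ G.Adj p q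

/-- `s(x, y)` is the only edge of `G - c` leaving the set `C` of vertices of `G - c`. -/
structure IsEdgeVertexCut (G : SimpleGraph V) (x y c : V) (C : Set V) : Prop where
  mem : x ∈ C
  notMem : y ∉ C
  vertex_notMem : c ∉ C
  ne : c ≠ y
  eq_of_adj : ∀ p ∈ C, ∀ q, q ∉ C → q ≠ c → G.Adj p q → p = x ∧ q = y

theorem IsEdgeVertexCut.symm {x y c : V} {C : Set V} (h : G.IsEdgeVertexCut x y c C) :
    G.IsEdgeVertexCut y x c {z | z ∉ C ∧ z ≠ c} where
  mem := ⟨h.notMem, h.ne.symm⟩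
  notMem := fun hx => hx.1 h.mem
  vertex_notMem := fun hc => hc.2 rfl
  ne := fun hcx => h.vertex_notMem (hcx ▸ h.mem)
  eq_of_adj := by
    intro p hp q hq hqc hpq
    have hqC : q ∈ C := by
      by_contra hqC
      exact hq ⟨hqC, hqc⟩
    exact (h.eq_of_adj q hqC p hp.1 hp.2 hpq.symm).symm

theorem exists_separation_of_not_preconnected {S : Set V}
    (h : ¬ (G.induce Sᶜ).Preconnected) :
    ∃ C : Set V, (∀ z ∈ C, z ∉ S) ∧ C.Nonempty ∧ (∃ z, z ∉ C ∧ z ∉ S) ∧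
      ∀ p ∈ C, ∀ q, q ∉ C → q ∉ S → ¬ G.Adj p q := by
  simp only [Preconnected, not_forall] at h
  obtain ⟨u, v, huv⟩ := h
  refine ⟨Subtype.val '' {z | (G.induce Sᶜ).Reachable u z}, ?_, ⟨u, u, Reachable.refl _, rfl⟩,
    ⟨v, ?_, v.2⟩, ?_⟩
  · rintro _ ⟨z, -, rfl⟩
    exact z.2
  · rintro ⟨z, hz, hzv⟩
    rw [Subtype.ext hzv] at hz
    exact huv hz
  · rintro _ ⟨p, hp, rfl⟩ q hq hqS hpq
    exact hq ⟨⟨q, hqS⟩, hp.trans (Adj.reachable (by simpa using hpq)), rfl⟩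

theorem not_preconnected_of_separation {S C : Set V} (hCS : ∀ z ∈ C, z ∉ S) (hC : C.Nonempty)
    (hz : ∃ z, z ∉ C ∧ z ∉ S) (hadj : ∀ p ∈ C, ∀ q, q ∉ C → q ∉ S → ¬ G.Adj p q) :
    ¬ (G.induce Sᶜ).Preconnected := by
  intro h
  obtain ⟨a, ha⟩ := hC
  obtain ⟨z, hzC, hzS⟩ := hz
  obtain ⟨w⟩ := h ⟨a, hCS a ha⟩ ⟨z, hzS⟩
  obtain ⟨d, -, hd1, hd2⟩ := w.exists_boundary_dart {t | t.1 ∈ C} ha hzC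
  exact hadj _ hd1 _ hd2 d.snd.2 (by simpa using d.adj)

theorem connectivity_le {S : Finset V}
    (h : ¬ (G.induce ((S : Set V)ᶜ)).Preconnected ∨ ((S : Set V)ᶜ).Subsingleton) :
    G.connectivity ≤ #S :=
  Nat.sInf_le ⟨S, rfl, h⟩

theorem noCutVertex_of_connectivity (h : 2 ≤ G.connectivity) : G.NoCutVertex := by
  classical
  intro c C hc hC hz
  by_contra hcon
  push Not at hcon
  have hle : G.connectivity ≤ #({c} : Finset V) := by
    refine connectivity_le (Or.inl (not_preconnected_of_separation (C := C) ?_ hC ?_ ?_))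
    · intro z hz hzc
      simp only [coe_singleton, Set.mem_singleton_iff] at hzc
      exact hc (hzc ▸ hz)
    · simpa using hz
    · intro p hp q hq hqc
      exact hcon p hp q hq (by simpa using hqc)
  rw [card_singleton] at hle
  omega

theorem three_le_card_of_connectivity [Fintype V] (h : 2 ≤ G.connectivity) :
    3 ≤ Fintype.card V := by
  classical
  by_contra hcard
  rcases isEmpty_or_nonempty V with hV | ⟨⟨v⟩⟩
  · have : G.connectivity ≤ #(∅ : Finset V) :=
      connectivity_le (Or.inr fun a => isEmptyElim a)
    simp only [card_empty] at this
    omega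
  · have : G.connectivity ≤ #({v} : Finset V) := by
      refine connectivity_le (Or.inr fun a ha b hb => ?_)
      simp only [coe_singleton, Set.mem_compl_iff, Set.mem_singleton_iff] at ha hb
      by_contra hab
      have : #({v, a, b} : Finset V) = 3 := by
        rw [card_eq_three]
        exact ⟨v, a, b, Ne.symm ha, Ne.symm hb, hab, rfl⟩
      have := card_le_univ ({v, a, b} : Finset V)
      omega
    rw [card_singleton] at this
    omega

theorem exists_ne_ne [Fintype V] (h : 3 ≤ Fintype.card V) (a b : V) : ∃ w, w ≠ a ∧ w ≠ b := by
  classical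
  by_contra hcon
  push Not at hcon
  have : (univ : Finset V) ⊆ {a, b} := by
    intro w _
    by_cases hw : w = a
    · simp [hw]
    · simp [hcon w hw]
  have h1 := card_le_card this
  have h2 : #({a, b} : Finset V) ≤ 2 := card_le_two
  rw [card_univ] at h1
  omega

theorem exists_cut_of_connectivity_lt_two [Fintype V] (hcard : 3 ≤ Fintype.card V)
    (h : G.connectivity < 2) :
    ∃ (c : V) (C : Set V), c ∉ C ∧ C.Nonempty ∧ (∃ z, z ∉ C ∧ z ≠ c) ∧
      ∀ p ∈ C, ∀ q, q ∉ C → q ≠ c → ¬ G.Adj p q := by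
  classical
  have hne : {k | ∃ S : Finset V, #S = k ∧
      (¬ (G.induce ((S : Set V)ᶜ)).Preconnected ∨ ((S : Set V)ᶜ).Subsingleton)}.Nonempty :=
    ⟨_, univ, rfl, Or.inr (by simp)⟩
  obtain ⟨S, hS, hcut⟩ := Nat.sInf_mem hne
  change #S = G.connectivity at hS
  have hS1 : #S ≤ 1 := by omega
  have hns : ¬ ((S : Set V)ᶜ).Subsingleton := by
    intro hsub
    rw [← coe_compl] at hsub
    have h1 := (card_le_one_iff_subsingleton (s := Sᶜ)).2 (by
      simpa using (Set.subsingleton_coe _).2 hsub)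
    rw [card_compl] at h1
    omega
  obtain ⟨C, hCS, ⟨a, ha⟩, ⟨b, hbC, hbS⟩, hadj⟩ :=
    exists_separation_of_not_preconnected (hcut.resolve_right hns)
  -- If the separator is empty, the graph is already disconnected and any third vertex serves as
  -- `c`; it may lie in `C`, hence `C \ {c}` below.
  obtain ⟨c, hcS, hca, hcb⟩ : ∃ c, (∀ z ∈ S, z = c) ∧ c ≠ a ∧ c ≠ b := by
    rcases S.eq_empty_or_nonempty with rfl | ⟨c, hc⟩
    · obtain ⟨w, hwa, hwb⟩ := exists_ne_ne hcard a b
      exact ⟨w, by simp, hwa, hwb⟩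
    · refine ⟨c, fun z hz => card_le_one.1 hS1 z hz c hc, ?_, ?_⟩
      · rintro rfl
        exact hCS _ ha (by simpa using hc)
      · rintro rfl
        exact hbS (by simpa using hc)
  refine ⟨c, C \ {c}, by simp, ⟨a, ha, by simpa using hca.symm⟩,
    ⟨b, fun hb => hbC hb.1, hcb.symm⟩, ?_⟩
  rintro p ⟨hp, -⟩ q hq hqc
  exact hadj p hp q (fun hq' => hq ⟨hq', by simpa using hqc⟩) fun hqS => hqc (hcS q hqS)

theorem IsMinimallyConnected.noCutVertex (h : G.IsMinimallyConnected 2) : G.NoCutVertex :=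
  noCutVertex_of_connectivity h.1.ge

theorem IsMinimallyConnected.three_le_card [Fintype V] (h : G.IsMinimallyConnected 2) :
    3 ≤ Fintype.card V :=
  three_le_card_of_connectivity h.1.ge

/-- A cut vertex `c` of `G - xy` is not one of `G`, so some edge of `G - c` crosses the separation,
and it can only be `xy`. If it crosses from `y` to `x`, the complementary side is used. -/
theorem IsMinimallyConnected.exists_isEdgeVertexCut [Fintype V] (h : G.IsMinimallyConnected 2)
    {x y : V} (hxy : G.Adj x y) : ∃ c C, G.IsEdgeVertexCut x y c C := by
  obtain ⟨c, C, hc, hC, hz, hadj⟩ :=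
    exists_cut_of_connectivity_lt_two h.three_le_card (h.2 s(x, y) hxy)
  have key : ∀ p ∈ C, ∀ q, q ∉ C → q ≠ c → G.Adj p q → s(p, q) = s(x, y) := by
    intro p hp q hq hqc hpq
    by_contra hne
    exact hadj p hp q hq hqc (by simpa [deleteEdges_adj, hpq] using hne)
  obtain ⟨p, hp, q, hq, hqc, hpq⟩ := h.noCutVertex c C hc hC hz
  have heq := key p hp q hq hqc hpq
  have hcut : G.IsEdgeVertexCut p q c C := by
    refine ⟨hp, hq, hc, hqc.symm, fun p' hp' q' hq' hqc' hpq' => ?_⟩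
    have := (key p' hp' q' hq' hqc' hpq').trans heq.symm
    rcases Sym2.eq_iff.1 this with h1 | h1
    · exact h1
    · exact absurd hp (h1.2 ▸ hq')
  rcases Sym2.eq_iff.1 heq with ⟨rfl, rfl⟩ | ⟨rfl, rfl⟩
  · exact ⟨c, C, hcut⟩
  · exact ⟨c, _, hcut.symm⟩

end SimpleGraph

/-! ### Upper bounds on local connectivity from mixed cuts and edge boundaries. -/

namespace SimpleGraph

variable {V : Type*} {G : SimpleGraph V}

theorem Walk.IsPath.eq_of_mem_edges {u v : V} {p q : G.Walk u v} (hp : p.IsPath)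
    (hq : q.IsPath) (hpe : s(u, v) ∈ p.edges) (hqe : s(u, v) ∈ q.edges) : p = q := by
  have key : ∀ (r : G.Walk u v), r.IsPath → s(u, v) ∈ r.edges → ∃ h : G.Adj u v,
      r = Walk.cons h Walk.nil := by
    intro r hr hre
    cases r with
    | nil => simp at hre
    | @cons _ w _ h r' =>
      rw [Walk.cons_isPath_iff] at hr
      rw [Walk.edges_cons, List.mem_cons] at hre
      have hwv : v = w := by
        rcases hre with hre | hre
        · rcases Sym2.eq_iff.1 hre with h1 | h1
          · exact h1.2
          · exact absurd h1.1 h.ne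
        · exact absurd (r'.fst_mem_support_of_mem_edges hre) hr.2
      subst hwv
      have := Walk.eq_nil_iff_nil.2 (Walk.isPath_iff_nil.1 hr.1)
      subst this
      exact ⟨h, rfl⟩
  obtain ⟨_, h1⟩ := key p hp hpe
  obtain ⟨_, h2⟩ := key q hq hqe
  rw [h1, h2]

/-- The easy half of Menger's theorem for mixed cuts. Sending each path to an element of the cut
that it meets is injective: a shared vertex of `X` would be an end, and a shared edge has to be
`uv`, which is then the whole of both paths. -/
theorem card_le_of_isDisjointPathFamily {u v : V} {X : Finset V} {Y : Finset (Sym2 V)}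
    (hu : u ∉ X) (hv : v ∉ X)
    (h : ∀ w : G.Walk u v, (∃ x ∈ X, x ∈ w.support) ∨ ∃ e ∈ Y, e ∈ w.edges)
    {S : Finset (G.Path u v)} (hS : G.IsDisjointPathFamily u v S) : #S ≤ #X + #Y := by
  classical
  have h' : ∀ p : G.Path u v, ∃ t ∈ X.disjSum Y,
      (∀ x, t = Sum.inl x → x ∈ p.1.support) ∧ ∀ e, t = Sum.inr e → e ∈ p.1.edges := by
    intro p
    rcases h p.1 with ⟨x, hx, hxp⟩ | ⟨e, he, hep⟩
    · exact ⟨Sum.inl x, by simpa using hx, by simpa using hxp, by simp⟩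
    · exact ⟨Sum.inr e, by simpa using he, by simp, by simpa using hep⟩
  choose f hf hfx hfe using h'
  rw [← card_disjSum]
  refine card_le_card_of_injOn f (fun p _ => hf p) ?_
  intro p hp q hq hpq
  by_contra hne
  have hdis := hS p hp q hq hne
  cases hfp : f p with
  | inl x =>
    have hxX : x ∈ X := by simpa [hfp] using hf p
    rcases hdis x (hfx p x hfp) (hfx q x (hpq ▸ hfp)) with rfl | rfl
    · exact hu hxX
    · exact hv hxX
  | inr e =>
    have h1 := hfe p e hfp
    have h2 := hfe q e (hpq ▸ hfp)
    induction e using Sym2.ind with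
    | _ a b =>
      have hab : a ≠ b := (p.1.adj_of_mem_edges h1).ne
      have ha := hdis a (p.1.fst_mem_support_of_mem_edges h1) (q.1.fst_mem_support_of_mem_edges h2)
      have hb := hdis b (p.1.snd_mem_support_of_mem_edges h1) (q.1.snd_mem_support_of_mem_edges h2)
      have huv : s(a, b) = s(u, v) := by
        rcases ha with rfl | rfl <;> rcases hb with rfl | rfl
        · exact absurd rfl hab
        · rfl
        · exact Sym2.eq_swap
        · exact absurd rfl hab
      rw [huv] at h1 h2
      exact hne (Subtype.ext (p.2.eq_of_mem_edges q.2 h1 h2))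

theorem pairConnectivity_le {u v : V} {X : Finset V} {Y : Finset (Sym2 V)}
    (hu : u ∉ X) (hv : v ∉ X)
    (h : ∀ w : G.Walk u v, (∃ x ∈ X, x ∈ w.support) ∨ ∃ e ∈ Y, e ∈ w.edges) :
    G.pairConnectivity u v ≤ #X + #Y := by
  refine csSup_le' ?_
  rintro k ⟨S, hS, rfl⟩
  exact card_le_of_isDisjointPathFamily hu hv h hS

theorem Walk.exists_edge_crossing {u v : V} (w : G.Walk u v) (C : Set V) (hu : u ∈ C)
    (hv : v ∉ C) : ∃ p q, p ∈ C ∧ q ∉ C ∧ G.Adj p q ∧ s(p, q) ∈ w.edges ∧ q ∈ w.support := by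
  obtain ⟨d, hd, h1, h2⟩ := w.exists_boundary_dart C hu hv
  exact ⟨d.fst, d.snd, h1, h2, d.adj, List.mem_map.2 ⟨d, hd, rfl⟩, w.dart_snd_mem_support_of_mem_darts hd⟩

theorem IsEdgeVertexCut.pairConnectivity_le_two {x y c : V} {C : Set V}
    (h : G.IsEdgeVertexCut x y c C) {u v : V} (hu : u ∈ C) (hv : v ∉ C) (hvc : v ≠ c) :
    G.pairConnectivity u v ≤ 2 := by
  refine (pairConnectivity_le (X := {c}) (Y := {s(x, y)}) ?_ ?_ ?_).trans (by simp)
  · rw [mem_singleton]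
    rintro rfl
    exact h.vertex_notMem hu
  · simpa using hvc
  · intro w
    obtain ⟨p, q, hp, hq, hpq, he, hqw⟩ := w.exists_edge_crossing C hu hv
    by_cases hqc : q = c
    · exact Or.inl ⟨c, by simp, hqc ▸ hqw⟩
    · obtain ⟨rfl, rfl⟩ := h.eq_of_adj p hp q hq hqc hpq
      exact Or.inr ⟨_, by simp, he⟩

section Boundary

variable [Fintype V]

open Classical in
/-- The number of edges with exactly one end in `C`. -/
noncomputable def edgeBoundaryCard (G : SimpleGraph V) (C : Finset V) : ℕ :=
  #{e ∈ C ×ˢ Cᶜ | G.Adj e.1 e.2}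

theorem pairConnectivity_le_edgeBoundaryCard {u v : V} {C : Finset V} (hu : u ∈ C) (hv : v ∉ C) :
    G.pairConnectivity u v ≤ G.edgeBoundaryCard C := by
  classical
  refine (pairConnectivity_le (X := ∅)
    (Y := ({e ∈ C ×ˢ Cᶜ | G.Adj e.1 e.2}).image fun e => s(e.1, e.2)) (by simp) (by simp) ?_).trans ?_
  · intro w
    obtain ⟨p, q, hp, hq, hpq, he, -⟩ := w.exists_edge_crossing (C : Set V) hu hv
    exact Or.inr ⟨_, mem_image.2 ⟨(p, q), by simpa using ⟨⟨hp, hq⟩, hpq⟩, rfl⟩, he⟩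
  · rw [card_empty, zero_add, edgeBoundaryCard]
    convert card_image_le

theorem edgeBoundaryCard_singleton [DecidableRel G.Adj] (u : V) :
    G.edgeBoundaryCard {u} = G.degree u := by
  classical
  rw [edgeBoundaryCard, ← card_neighborFinset_eq_degree]
  refine card_bij' (fun e _ => e.2) (fun w _ => (u, w)) ?_ ?_ ?_ ?_
  · rintro ⟨a, b⟩ h
    simp only [mem_filter, mem_product, mem_singleton, mem_compl] at h
    simpa using h.1.1 ▸ h.2
  · intro w h
    rw [mem_neighborFinset] at h
    simpa using ⟨h.ne.symm, h⟩
  · rintro ⟨a, b⟩ h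
    simp only [mem_filter, mem_product, mem_singleton, mem_compl] at h
    simp [h.1.1]
  · simp

theorem edgeBoundaryCard_compl [DecidableEq V] (C : Finset V) :
    G.edgeBoundaryCard Cᶜ = G.edgeBoundaryCard C := by
  rw [edgeBoundaryCard, edgeBoundaryCard]
  refine card_bij' (fun e _ => (e.2, e.1)) (fun e _ => (e.2, e.1)) ?_ ?_ ?_ ?_ <;>
    simp +contextual [G.adj_comm]

theorem pairConnectivity_le_degree [DecidableRel G.Adj] {u v : V} (huv : u ≠ v) :
    G.pairConnectivity u v ≤ G.degree u := by
  classical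
  rw [← edgeBoundaryCard_singleton]
  exact pairConnectivity_le_edgeBoundaryCard (by simp) (by simpa using huv.symm)

/-- Given one crossing edge `pq` and a third vertex `w`, delete whichever of `p`, `q` lies on the
side of `w`. Both sides stay nonempty, so another edge crosses. -/
theorem NoCutVertex.two_le_edgeBoundaryCard (h : G.NoCutVertex) (hcard : 3 ≤ Fintype.card V)
    {C : Finset V} {a b : V} (ha : a ∈ C) (hb : b ∉ C) : 2 ≤ G.edgeBoundaryCard C := by
  classical
  have key : ∃ e e' : V × V, e ≠ e' ∧ (e.1 ∈ C ∧ e.2 ∉ C ∧ G.Adj e.1 e.2) ∧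
      (e'.1 ∈ C ∧ e'.2 ∉ C ∧ G.Adj e'.1 e'.2) := by
    have first : ∃ p ∈ C, ∃ q, q ∉ C ∧ G.Adj p q := by
      obtain ⟨w, hwa, hwb⟩ := exists_ne_ne hcard a b
      obtain ⟨p, hp, q, hq, hqw, hpq⟩ := h w ((C : Set V) \ {w}) (by simp)
        ⟨a, ha, by simpa using hwa.symm⟩ ⟨b, fun hb' => hb hb'.1, hwb.symm⟩
      exact ⟨p, hp.1, q, fun hqC => hq ⟨hqC, by simpa using hqw⟩, hpq⟩
    obtain ⟨p, hp, q, hq, hpq⟩ := first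
    obtain ⟨w, hwp, hwq⟩ := exists_ne_ne hcard p q
    by_cases hwC : w ∈ C
    · obtain ⟨p', hp', q', hq', hqp', hpq'⟩ := h p ((C : Set V) \ {p}) (by simp)
        ⟨w, hwC, by simpa using hwp⟩ ⟨q, fun hq' => hq hq'.1, fun hqp => hq (hqp ▸ hp)⟩
      refine ⟨(p, q), (p', q'), ?_, ⟨hp, hq, hpq⟩, hp'.1,
        fun hqC => hq' ⟨hqC, by simpa using hqp'⟩, hpq'⟩
      rintro heq
      exact hp'.2 (Prod.ext_iff.1 heq).1.symm
    · obtain ⟨p', hp', q', hq', hqp', hpq'⟩ := h q (C : Set V) (by simpa using hq)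
        ⟨p, hp⟩ ⟨w, by simpa using hwC, hwq⟩
      refine ⟨(p, q), (p', q'), ?_, ⟨hp, hq, hpq⟩, hp', by simpa using hq', hpq'⟩
      rintro heq
      exact hqp' (Prod.ext_iff.1 heq).2.symm
  obtain ⟨e, e', hne, he, he'⟩ := key
  rw [← card_pair hne, edgeBoundaryCard]
  refine card_le_card ?_
  intro t ht
  rw [mem_insert, mem_singleton] at ht
  rcases ht with rfl | rfl
  · simpa [and_assoc] using he
  · simpa [and_assoc] using he'

theorem NoCutVertex.two_le_degree [DecidableRel G.Adj] (h : G.NoCutVertex)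
    (hcard : 3 ≤ Fintype.card V) (u : V) : 2 ≤ G.degree u := by
  obtain ⟨w, hw, -⟩ := exists_ne_ne hcard u u
  rw [← edgeBoundaryCard_singleton]
  exact h.two_le_edgeBoundaryCard hcard (mem_singleton_self u) (b := w) (by simpa using hw)

/-- A set of vertices `W` that can be separated pairwise in `G - u` by bridges of `G - u` sends
little excess connectivity across any edge boundary. -/
theorem NoCutVertex.sum_add_two_le_edgeBoundaryCard [DecidableEq V] (h : G.NoCutVertex)
    (hcard : 3 ≤ Fintype.card V) {u : V} {W : Finset V} {g : V → ℕ}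
    (hg : ∀ v ∈ W, ∀ C : Finset V, v ∈ C → u ∉ C → g v + 2 ≤ G.edgeBoundaryCard C)
    (hW : ∀ v₁ ∈ W, ∀ v₂ ∈ W, v₁ ≠ v₂ → ∃ x y C, G.IsEdgeVertexCut x y u C ∧ v₁ ∈ C ∧ v₂ ∉ C)
    {C : Finset V} (hC : C.Nonempty) (hu : u ∉ C) :
    ∑ v ∈ W with v ∈ C, g v + 2 ≤ G.edgeBoundaryCard C := by
  classical
  induction hn : #{v ∈ W | v ∈ C} using Nat.strong_induction_on generalizing C with
  | _ n ih =>
  subst hn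
  rcases le_or_gt #{v ∈ W | v ∈ C} 1 with h1 | h1
  · rcases Nat.le_one_iff_eq_zero_or_eq_one.1 h1 with h0 | h1
    · rw [card_eq_zero] at h0
      obtain ⟨a, ha⟩ := hC
      rw [h0, sum_empty, zero_add]
      exact h.two_le_edgeBoundaryCard hcard ha hu
    · obtain ⟨v, hv⟩ := card_eq_one.1 h1
      have hvm : v ∈ ({v ∈ W | v ∈ C} : Finset V) := by simp [hv]
      rw [mem_filter] at hvm
      rw [hv, sum_singleton]
      exact hg v hvm.1 C hvm.2 hu
  · obtain ⟨v₁, hv₁, v₂, hv₂, hne⟩ := one_lt_card.1 h1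
    rw [mem_filter] at hv₁ hv₂
    obtain ⟨x, y, D, hD, hD₁, hD₂⟩ := hW v₁ hv₁.1 v₂ hv₂.1 hne
    set A : Finset V := {v ∈ C | v ∈ D} with hA
    set B : Finset V := {v ∈ C | v ∉ D} with hB
    have hvA : v₁ ∈ A := by simp [hA, hv₁.2, hD₁]
    have hvB : v₂ ∈ B := by simp [hB, hv₂.2, hD₂]
    have hltA : #{v ∈ W | v ∈ A} < #{v ∈ W | v ∈ C} := by
      refine card_lt_card ((ssubset_iff_of_subset ?_).2 ⟨v₂, ?_, ?_⟩)
      · intro v; simp +contextual [hA]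
      · simp [hv₂]
      · simp [hA, hD₂]
    have hltB : #{v ∈ W | v ∈ B} < #{v ∈ W | v ∈ C} := by
      refine card_lt_card ((ssubset_iff_of_subset ?_).2 ⟨v₁, ?_, ?_⟩)
      · intro v; simp +contextual [hB]
      · simp [hv₁]
      · simp [hB, hD₁]
    have hiA := ih _ hltA ⟨v₁, hvA⟩ (by simp [hA, hu]) rfl
    have hiB := ih _ hltB ⟨v₂, hvB⟩ (by simp [hB, hu]) rfl
    have hsum : ∑ v ∈ W with v ∈ C, g v =
        ∑ v ∈ W with v ∈ A, g v + ∑ v ∈ W with v ∈ B, g v := by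
      rw [← sum_filter_add_sum_filter_not _ (fun v => v ∈ D), filter_filter, filter_filter]
      simp only [hA, hB, mem_filter]
    -- Splitting `C` along `D` creates no new boundary edge except `xy`, counted once on each side.
    -- So the boundaries of `A` and `B` total at most that of `C` plus two, which pays for the
    -- second `+ 2` of the induction hypotheses.
    have hbA : G.edgeBoundaryCard A ≤
        #{e ∈ ({e ∈ C ×ˢ Cᶜ | G.Adj e.1 e.2} : Finset (V × V)) | e.1 ∈ D} + 1 := by
      rw [edgeBoundaryCard]
      refine (card_le_card (t := insert (x, y) _) ?_).trans (card_insert_le _ _)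
      rintro ⟨p, q⟩ hpq
      simp only [hA, mem_filter, mem_product, mem_compl, not_and, mem_insert] at hpq ⊢
      obtain ⟨⟨⟨hpC, hpD⟩, hq⟩, hadj⟩ := hpq
      by_cases hqC : q ∈ C
      · left
        obtain ⟨rfl, rfl⟩ := hD.eq_of_adj p hpD q (hq hqC) (fun hqu => hu (hqu ▸ hqC)) hadj
        rfl
      · exact Or.inr ⟨⟨⟨hpC, hqC⟩, hadj⟩, hpD⟩
    have hbB : G.edgeBoundaryCard B ≤
        #{e ∈ ({e ∈ C ×ˢ Cᶜ | G.Adj e.1 e.2} : Finset (V × V)) | e.1 ∉ D} + 1 := by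
      rw [edgeBoundaryCard]
      refine (card_le_card (t := insert (y, x) _) ?_).trans (card_insert_le _ _)
      rintro ⟨p, q⟩ hpq
      simp only [hB, mem_filter, mem_product, mem_compl, not_and, not_not, mem_insert] at hpq ⊢
      obtain ⟨⟨⟨hpC, hpD⟩, hq⟩, hadj⟩ := hpq
      by_cases hqC : q ∈ C
      · left
        obtain ⟨rfl, rfl⟩ :=
          hD.eq_of_adj q (hq hqC) p hpD (fun hpu => hu (hpu ▸ hpC)) hadj.symm
        rfl
      · exact Or.inr ⟨⟨⟨hpC, hqC⟩, hadj⟩, hpD⟩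
    have hb : #{e ∈ ({e ∈ C ×ˢ Cᶜ | G.Adj e.1 e.2} : Finset (V × V)) | e.1 ∈ D} +
        #{e ∈ ({e ∈ C ×ˢ Cᶜ | G.Adj e.1 e.2} : Finset (V × V)) | e.1 ∉ D} =
        G.edgeBoundaryCard C := by
      rw [card_filter_add_card_filter_not, edgeBoundaryCard]
      congr!
    omega

end Boundary

end SimpleGraph

/-! ### The vertices of degree at least three induce a forest. -/

namespace SimpleGraph

variable {V : Type*} {G : SimpleGraph V} [Fintype V] [DecidableRel G.Adj]

/-- The spanning subgraph of `G` whose edges join vertices of degree at least three. -/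
def branchGraph (G : SimpleGraph V) [DecidableRel G.Adj] : SimpleGraph V where
  Adj u v := G.Adj u v ∧ 3 ≤ G.degree u ∧ 3 ≤ G.degree v
  symm := ⟨fun _ _ h => ⟨h.1.symm, h.2.2, h.2.1⟩⟩
  loopless := ⟨fun _ h => h.1.ne rfl⟩

/-- Take the cut `(c', D)` of the first edge `yw` of the path. If `c'` lies on the rest of the path,
the same configuration recurs with a shorter path. Otherwise the rest cannot enter `D`, so `c ∉ D`,
and crossing `C` with `D` shows that `y` would be a cut vertex of `G`. -/
theorem IsMinimallyConnected.not_isEdgeVertexCut_of_walk (h : G.IsMinimallyConnected 2)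
    {x y c : V} {C : Set V} (hxy : G.branchGraph.Adj x y) (hcut : G.IsEdgeVertexCut x y c C)
    (P : G.branchGraph.Walk y c) (hP : P.IsPath) (hx : x ∉ P.support) : False := by
  classical
  induction hn : P.length using Nat.strong_induction_on generalizing x y c C P with
  | _ n ih =>
  subst hn
  cases P with
  | nil => exact hcut.ne rfl
  | @cons _ w _ hyw P =>
    rw [Walk.cons_isPath_iff] at hP
    rw [Walk.support_cons, List.mem_cons, not_or] at hx
    have hxw : x ≠ w := fun hxw => hx.2 (hxw ▸ P.start_mem_support)
    obtain ⟨c', D, hD⟩ := h.exists_isEdgeVertexCut hyw.1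
    by_cases hc' : c' ∈ P.support
    · refine ih (P.takeUntil c' hc').length ?_ hyw hD (P.takeUntil c' hc') (hP.1.takeUntil hc')
        (fun hy => hP.2 (P.support_takeUntil_subset_support hc' hy)) rfl
      rw [Walk.length_cons]
      exact Nat.lt_succ_of_le (P.length_takeUntil_le_length hc')
    · have hcc' : c ≠ c' := fun hcc' => hc' (hcc' ▸ P.end_mem_support)
      have hcD : c ∉ D := by
        intro hcD
        obtain ⟨d, hd, hd1, hd2⟩ := P.exists_boundary_dart Dᶜ hD.notMem (by simpa using hcD)
        have h1 := P.dart_fst_mem_support_of_mem_darts hd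
        have h2 := P.dart_snd_mem_support_of_mem_darts hd
        obtain ⟨h3, -⟩ := hD.eq_of_adj d.snd (by simpa using hd2) d.fst hd1
          (fun h4 => hc' (h4 ▸ h1)) d.adj.1.symm
        exact hP.2 (h3 ▸ h2)
      -- Otherwise `C ∩ D` contains `x`, and every edge leaving it ends at `y`.
      have hc'C : c' ∈ C := by
        by_contra hc'C
        have hxD : x ∈ D := by
          by_contra hxD
          exact hxw (hD.eq_of_adj y hD.mem x hxD (fun hxc => hc'C (hxc ▸ hcut.mem)) hxy.1.symm).2
        obtain ⟨p, hp, q, hq, hqy, hpq⟩ := h.noCutVertex y (C ∩ D) (fun hy => hcut.notMem hy.1)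
          ⟨x, hcut.mem, hxD⟩ ⟨c, fun hc => hcD hc.2, hcut.ne⟩
        have hqc' : q ≠ c := by
          rintro rfl
          exact hcut.notMem
            ((hD.eq_of_adj p hp.2 q hcD hcc' hpq).1 ▸ hp.1)
        by_cases hqC : q ∈ C
        · exact hcut.notMem ((hD.eq_of_adj p hp.2 q (fun hqD => hq ⟨hqC, hqD⟩)
            (fun hqc => hc'C (hqc ▸ hqC)) hpq).1 ▸ hp.1)
        · exact hqy (hcut.eq_of_adj p hp.1 q hqC hqc' hpq).2
      -- This is where degree at least three enters: the third neighbour `p` of `y` lies in `D \ C`,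
      -- and every edge leaving `D \ C` with `y` removed ends at `y`.
      obtain ⟨p, hyp, hpx, hpw⟩ : ∃ p, G.Adj y p ∧ p ≠ x ∧ p ≠ w := by
        by_contra hcon
        push Not at hcon
        have hsub : G.neighborFinset y ⊆ {x, w} := by
          intro p hp
          rw [mem_neighborFinset] at hp
          by_cases hpx : p = x
          · simp [hpx]
          · simp [hcon p hp hpx]
        have h1 := card_le_card hsub
        have h2 : #({x, w} : Finset V) ≤ 2 := card_le_two
        have h3 := hxy.2.2
        rw [card_neighborFinset_eq_degree] at h1
        omega
      have hyc : y ≠ c := hcut.ne.symm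
      have hyc' : y ≠ c' := fun hyc' => hcut.notMem (hyc' ▸ hc'C)
      have hpC : p ∉ C := by
        intro hpC
        exact hpx (hcut.eq_of_adj p hpC y hcut.notMem hyc hyp.symm).1
      have hpD : p ∈ D := by
        by_contra hpD
        exact hpw (hD.eq_of_adj y hD.mem p hpD (fun hpc => hpC (hpc ▸ hc'C)) hyp).2
      obtain ⟨a, ha, b, hb, hby, hab⟩ := h.noCutVertex y {z | z ∉ C ∧ z ∈ D ∧ z ≠ y}
        (fun hy => hy.2.2 rfl) ⟨p, hpC, hpD, hyp.ne.symm⟩ ⟨c, fun hc => hcD hc.2.1, hcut.ne⟩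
      by_cases hbC : b ∈ C
      · have hac : a ≠ c := fun hac => hcD (hac ▸ ha.2.1)
        exact ha.2.2 (hcut.eq_of_adj b hbC a ha.1 hac hab.symm).2
      · have hbD : b ∉ D := fun hbD => hb ⟨hbC, hbD, hby⟩
        exact ha.2.2 (hD.eq_of_adj a ha.2.1 b hbD (fun hbc => hbC (hbc ▸ hc'C)) hab).1

theorem IsMinimallyConnected.not_reachable_branchGraph (h : G.IsMinimallyConnected 2)
    {x y c : V} {C : Set V} (hxy : G.branchGraph.Adj x y) (hcut : G.IsEdgeVertexCut x y c C) :
    ¬ G.branchGraph.Reachable x c := by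
  classical
  intro hr
  obtain ⟨P, hP⟩ := hr.exists_isPath
  by_cases hy : y ∈ P.support
  · refine h.not_isEdgeVertexCut_of_walk hxy hcut (P.dropUntil y hy) (hP.dropUntil hy) ?_
    intro hx
    have h1 := hP
    rw [← P.take_spec hy] at h1
    have h2 : x ∈ (P.dropUntil y hy).support.tail := by
      rw [← Walk.cons_tail_support, List.mem_cons] at hx
      exact hx.resolve_left hxy.ne
    have h3 := h1.support_nodup
    rw [Walk.support_append, List.nodup_append] at h3
    exact h3.2.2 x (Walk.start_mem_support _) x h2 rfl
  · exact h.not_isEdgeVertexCut_of_walk hxy.symm hcut.symm P hP hy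

/-- A walk in the forest's candidate from `x` to `y` avoiding the edge `xy` must leave `C` through
the cut vertex `c`, which `x` cannot reach. -/
theorem IsMinimallyConnected.branchGraph_isAcyclic (h : G.IsMinimallyConnected 2) :
    G.branchGraph.IsAcyclic := by
  rw [isAcyclic_iff_forall_adj_isBridge]
  intro x y hxy
  rw [isBridge_iff]
  rintro ⟨w⟩
  obtain ⟨c, C, hcut⟩ := h.exists_isEdgeVertexCut hxy.1
  obtain ⟨d, hd, h1, h2⟩ := w.exists_boundary_dart C hcut.mem hcut.notMem
  have hd3 : d.snd ≠ c := by
    intro hdc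
    refine h.not_reachable_branchGraph hxy hcut ?_
    classical
    have : (G.branchGraph.deleteEdges {s(x, y)}).Reachable x c := by
      rw [← hdc]
      exact ⟨w.takeUntil _ (w.dart_snd_mem_support_of_mem_darts hd)⟩
    exact this.mono (deleteEdges_le _)
  have hadj := d.adj
  rw [deleteEdges_adj] at hadj
  obtain ⟨h4, h5⟩ := hcut.eq_of_adj _ h1 _ h2 hd3 hadj.1.1
  exact hadj.2 (by rw [h4, h5]; rfl)

/-- The cut of the first edge of the path from `u` to `v` works: the rest of the path avoids both
`u` and the cut vertex, so it never returns to `C`. -/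
theorem IsMinimallyConnected.exists_isEdgeVertexCut_of_reachable (h : G.IsMinimallyConnected 2)
    {u v : V} (huv : u ≠ v) (hr : G.branchGraph.Reachable u v) :
    ∃ x y c C, G.IsEdgeVertexCut x y c C ∧ u ∈ C ∧ v ∉ C ∧ v ≠ c := by
  obtain ⟨P, hP⟩ := hr.exists_isPath
  cases P with
  | nil => exact absurd rfl huv
  | @cons _ y _ huy P =>
    rw [Walk.cons_isPath_iff] at hP
    obtain ⟨c, C, hcut⟩ := h.exists_isEdgeVertexCut huy.1
    have hc := h.not_reachable_branchGraph huy hcut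
    refine ⟨u, y, c, C, hcut, hcut.mem, ?_, fun hvc => hc (hvc ▸ hr)⟩
    intro hv
    obtain ⟨d, hd, h1, h2⟩ := P.exists_boundary_dart Cᶜ hcut.notMem (by simpa using hv)
    have hdP := P.dart_fst_mem_support_of_mem_darts hd
    have hdc : d.fst ≠ c := by
      classical
      intro hdc
      refine hc (huy.reachable.trans ?_)
      rw [← hdc]
      exact ⟨P.takeUntil _ hdP⟩
    obtain ⟨h4, -⟩ := hcut.eq_of_adj d.snd (by simpa using h2) d.fst h1 hdc d.adj.1.symm
    exact hP.2 (h4 ▸ P.dart_snd_mem_support_of_mem_darts hd)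

theorem IsMinimallyConnected.pairConnectivity_le_two_of_reachable (h : G.IsMinimallyConnected 2)
    {u v : V} (huv : u ≠ v) (hr : G.branchGraph.Reachable u v) : G.pairConnectivity u v ≤ 2 := by
  obtain ⟨x, y, c, C, hcut, hu, hv, hvc⟩ := h.exists_isEdgeVertexCut_of_reachable huv hr
  exact hcut.pairConnectivity_le_two hu hv hvc

/-- The excess connectivity from a vertex `u` to another component of the branch graph is at most
`deg u - 2`. -/
theorem IsMinimallyConnected.sum_component_add_two_le_degree [DecidableEq V]
    (h : G.IsMinimallyConnected 2) {u v₀ : V} (hu : ¬ G.branchGraph.Reachable v₀ u)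
    {T : Finset V} (hT : ∀ v ∈ T, G.branchGraph.Reachable v₀ v) :
    ∑ v ∈ T, (G.pairConnectivity u v - 2) + 2 ≤ G.degree u := by
  classical
  have hne : ∀ v ∈ T, v ≠ u := fun v hv hvu => hu (hvu ▸ hT v hv)
  have hsum : ∑ v ∈ T, (G.pairConnectivity u v - 2) =
      ∑ v ∈ ({v ∈ T | 3 ≤ G.pairConnectivity u v} : Finset V) with v ∈ ({u}ᶜ : Finset V),
        (G.pairConnectivity u v - 2) := by
    symm
    rw [filter_filter]
    refine sum_subset (filter_subset _ _) fun v hv hv' => ?_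
    have : ¬ 3 ≤ G.pairConnectivity u v := by
      intro h3
      exact hv' (by simp [hv, h3, hne v hv])
    omega
  obtain ⟨w, hw, -⟩ := exists_ne_ne h.three_le_card u u
  rw [hsum, ← edgeBoundaryCard_singleton, ← edgeBoundaryCard_compl]
  -- Applied to the complement of `u`, whose edge boundary has size `deg u`. Restricting to pairs of
  -- connectivity at least three makes the truncated excess plus two equal to the connectivity.
  refine h.noCutVertex.sum_add_two_le_edgeBoundaryCard h.three_le_card (u := u) ?_ ?_
    ⟨w, by simpa using hw⟩ (by simp)
  · intro v hv C hvC huC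
    have h3 := (mem_filter.1 hv).2
    have := pairConnectivity_le_edgeBoundaryCard (G := G) hvC huC
    rw [pairConnectivity_comm] at this
    omega
  · intro v₁ hv₁ v₂ hv₂ h12
    rw [mem_filter] at hv₁ hv₂
    obtain ⟨x, y, c, C, hcut, h1, h2, h2c⟩ :=
      h.exists_isEdgeVertexCut_of_reachable h12 ((hT v₁ hv₁.1).symm.trans (hT v₂ hv₂.1))
    -- If the cut vertex were not `u`, then `u` would be cut off from `v₁` or from `v₂` by a vertex
    -- and an edge, contrary to connectivity at least three.
    by_cases huc : u = c
    · subst huc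
      exact ⟨x, y, C, hcut, h1, h2⟩
    exfalso
    by_cases huC : u ∈ C
    · have := hcut.pairConnectivity_le_two huC h2 h2c
      omega
    · have := hcut.pairConnectivity_le_two h1 huC huc
      rw [pairConnectivity_comm] at this
      omega

end SimpleGraph

/-! ### Two internally disjoint paths in a graph without cut vertices. -/

namespace SimpleGraph

variable {V : Type*} {G : SimpleGraph V}

/-- A walk ending in `S` contains a path from its start to its first vertex in `S`. -/
theorem Walk.exists_isPath_to_first {u v : V} (w : G.Walk u v) (S : Set V) (hv : v ∈ S) :
    ∃ x ∈ S, ∃ r : G.Walk u x, r.IsPath ∧ (∀ z ∈ r.support, z ∈ w.support) ∧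
      ∀ z ∈ r.support, z ∈ S → z = x := by
  classical
  induction w with
  | nil => exact ⟨_, hv, Walk.nil, by simp, by simp, by simp⟩
  | @cons a b _ hab w ih =>
    by_cases ha : a ∈ S
    · exact ⟨a, ha, Walk.nil, by simp, by simp, by simp⟩
    · obtain ⟨x, hx, r, -, hrw, hrS⟩ := ih hv
      refine ⟨x, hx, (Walk.cons hab r).bypass, Walk.bypass_isPath _, ?_, ?_⟩
      · intro z hz
        have := Walk.support_bypass_subset_support _ hz
        rw [Walk.support_cons, List.mem_cons] at this ⊢
        exact this.imp_right (hrw z)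
      · intro z hz hzS
        have := Walk.support_bypass_subset_support _ hz
        rw [Walk.support_cons, List.mem_cons] at this
        rcases this with rfl | h
        · exact absurd hzS ha
        · exact hrS z h hzS

theorem NoCutVertex.exists_walk_avoiding (h : G.NoCutVertex) {a b c : V} (ha : a ≠ c)
    (hb : b ≠ c) : ∃ w : G.Walk a b, c ∉ w.support := by
  by_contra hcon
  push Not at hcon
  obtain ⟨p, ⟨hpc, w, hw⟩, q, hq, hqc, hpq⟩ :=
    h c {z | z ≠ c ∧ ∃ w : G.Walk a z, c ∉ w.support} (fun hc => hc.1 rfl)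
      ⟨a, ha, Walk.nil, by simpa using ha.symm⟩ ⟨b, fun hb' => by
        obtain ⟨-, w, hw⟩ := hb'
        exact hw (hcon w), hb⟩
  refine hq ⟨hqc, w.concat hpq, ?_⟩
  rw [Walk.support_concat]
  simpa [hw] using hqc.symm

/-- Two distinct internally disjoint `u`–`v` paths exist. -/
def HasTwoPaths (G : SimpleGraph V) (u v : V) : Prop :=
  ∃ P Q : G.Walk u v, P.IsPath ∧ Q.IsPath ∧ P ≠ Q ∧ InternallyDisjoint u v P.support Q.support

theorem Walk.IsPath.append_reverse {u v x : V} {P : G.Walk u x} {R : G.Walk v x} (hP : P.IsPath)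
    (hR : R.IsPath) (h : ∀ z ∈ R.support, z ∈ P.support → z = x) :
    (P.append R.reverse).IsPath := by
  rw [Walk.isPath_def, Walk.support_append, List.nodup_append]
  have hR' := hR.reverse
  rw [Walk.isPath_def, ← Walk.cons_tail_support, List.nodup_cons] at hR'
  refine ⟨hP.support_nodup, hR'.2, ?_⟩
  rintro a ha b hb rfl
  have hb' : a ∈ R.support := by
    have := List.mem_of_mem_tail hb
    rwa [Walk.support_reverse, List.mem_reverse] at this
  exact hR'.1 (h a hb' ha ▸ hb)

/-- Whitney's rerouting: follow a path from `v` to `u` avoiding `w` until it first meets `P ∪ Q`,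
say on `P`. The initial part of `P` continued back along it to `v`, and `Q` followed by `wv`, are
the new paths. -/
theorem NoCutVertex.hasTwoPaths_of_adj (h : G.NoCutVertex) {u v w : V} (hwu : w ≠ u)
    (hvu : v ≠ u) (hw : G.HasTwoPaths u w) (hwv : G.Adj w v) : G.HasTwoPaths u v := by
  classical
  obtain ⟨P, Q, hP, hQ, hPQ, hdis⟩ := hw
  obtain ⟨R, hR⟩ := h.exists_walk_avoiding (a := v) (b := u) (c := w) hwv.ne.symm hwu.symm
  obtain ⟨x, hx, R', hR', hR'R, hR'S⟩ := R.exists_isPath_to_first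
    {z | z ∈ P.support ∨ z ∈ Q.support} (Or.inl P.start_mem_support)
  -- Distinctness of the old paths is not needed: only one of the new paths passes through `w`.
  clear hPQ
  wlog hxP : x ∈ P.support generalizing P Q
  · exact this Q P hQ hP (fun z hz hz' => hdis z hz' hz) hx.symm
      (fun z hz hz' => hR'S z hz hz'.symm) (hx.resolve_left hxP)
  have hwR' : w ∉ R'.support := fun hw => hR (hR'R w hw)
  have hxw : x ≠ w := fun hxw => hwR' (hxw ▸ R'.end_mem_support)
  have hvQ : v ∉ Q.support := by
    intro hvQ
    have hvx := hR'S v R'.start_mem_support (Or.inr hvQ)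
    rcases hdis v (hvx ▸ hxP) hvQ with h1 | h1
    · exact hvu h1
    · exact hwv.ne h1.symm
  have hwT : w ∉ (P.takeUntil x hxP).support :=
    Walk.endpoint_notMem_support_takeUntil hP hxP hxw.symm
  have hT : ∀ z ∈ (P.takeUntil x hxP).support, z ∈ P.support := fun z hz =>
    P.support_takeUntil_subset_support hxP hz
  have hmem : ∀ z, z ∈ ((P.takeUntil x hxP).append R'.reverse).support →
      z ∈ (P.takeUntil x hxP).support ∨ z ∈ R'.support := by
    intro z hz
    rw [Walk.mem_support_append_iff, Walk.support_reverse, List.mem_reverse] at hz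
    exact hz
  have hwmem : w ∈ (Q.concat hwv).support := by
    rw [Walk.support_concat]
    simp
  have hwnot : w ∉ ((P.takeUntil x hxP).append R'.reverse).support := fun hz =>
    (hmem w hz).elim hwT hwR'
  refine ⟨(P.takeUntil x hxP).append R'.reverse, Q.concat hwv,
    (hP.takeUntil hxP).append_reverse hR' fun z hz hz' => hR'S z hz (Or.inl (hT z hz')),
    hQ.concat hvQ hwv, fun heq => hwnot (heq ▸ hwmem), ?_⟩
  intro z hz hz'
  have hzw : z ≠ w := fun hzw => hwnot (hzw ▸ hz)
  rw [Walk.support_concat, List.mem_append, List.mem_singleton] at hz'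
  rcases hz' with hzQ | rfl
  · have hzP : z ∈ P.support := by
      rcases hmem z hz with hz | hz
      · exact hT z hz
      · exact hR'S z hz (Or.inr hzQ) ▸ hxP
    exact (hdis z hzP hzQ).imp_right fun hzw' => absurd hzw' hzw
  · exact Or.inr rfl

theorem NoCutVertex.hasTwoPaths [Fintype V] (h : G.NoCutVertex) (hcard : 3 ≤ Fintype.card V)
    {u v : V} (huv : u ≠ v) : G.HasTwoPaths u v := by
  classical
  have base : ∀ v, G.Adj u v → G.HasTwoPaths u v := by
    intro v huv
    obtain ⟨z, hz⟩ : ∃ z, G.Adj v z ∧ z ≠ u := by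
      have h2 := h.two_le_degree hcard v
      rw [← card_neighborFinset_eq_degree] at h2
      obtain ⟨z, hz, hzu⟩ := exists_mem_ne (s := G.neighborFinset v) (by omega) u
      exact ⟨z, by simpa using hz, hzu⟩
    obtain ⟨w, hw⟩ := h.exists_walk_avoiding (a := z) (b := u) (c := v) hz.1.ne.symm huv.ne
    have hvb : v ∉ w.bypass.support := fun hv => hw (w.support_bypass_subset_support hv)
    have hp : (Walk.cons hz.1 w.bypass).reverse.IsPath :=
      (w.bypass_isPath.cons hvb).reverse
    refine ⟨Walk.cons huv Walk.nil, (Walk.cons hz.1 w.bypass).reverse, ?_, hp, ?_, ?_⟩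
    · simpa [Walk.cons_isPath_iff] using huv.ne
    · intro heq
      have hzm : z ∈ (Walk.cons hz.1 w.bypass).reverse.support := by simp
      rw [← heq] at hzm
      simp only [Walk.support_cons, Walk.support_nil, List.mem_cons, List.not_mem_nil,
        or_false] at hzm
      exact hzm.elim hz.2 hz.1.ne.symm
    · intro x hx _
      simpa using hx
  by_contra hcon
  obtain ⟨t, htu, htv⟩ := exists_ne_ne hcard u v
  obtain ⟨W, hW⟩ := h.exists_walk_avoiding (a := u) (b := v) htu.symm htv.symm
  obtain ⟨d, -, h1, h2⟩ := W.exists_boundary_dart {z | z = u ∨ G.HasTwoPaths u z} (Or.inl rfl)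
    (by
      rintro (hvu | hv)
      · exact huv hvu.symm
      · exact hcon hv)
  simp only [Set.mem_ofPred_eq, not_or] at h1 h2
  rcases eq_or_ne d.fst u with h3 | h3
  · exact h2.2 (base _ (h3 ▸ d.adj))
  · exact h2.2 (h.hasTwoPaths_of_adj h3 h2.1 (h1.resolve_left h3) d.adj)

theorem HasTwoPaths.two_le_pairConnectivity [Fintype V] {u v : V} (huv : u ≠ v)
    (h : G.HasTwoPaths u v) : 2 ≤ G.pairConnectivity u v := by
  classical
  obtain ⟨P, Q, hP, hQ, hPQ, hdis⟩ := h
  -- A supremum in `ℕ` bounds its members only when the set is bounded. Here the cut consisting of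
  -- all edges and no vertex gives a bound.
  refine le_csSup ⟨0 + #(univ : Finset (Sym2 V)), ?_⟩ ⟨{⟨P, hP⟩, ⟨Q, hQ⟩}, ?_, ?_⟩
  · rintro k ⟨S, hS, rfl⟩
    refine card_le_of_isDisjointPathFamily (X := ∅) (by simp) (by simp) ?_ hS
    intro w
    obtain ⟨p, q, -, -, -, he, -⟩ := w.exists_edge_crossing {u} rfl huv.symm
    exact Or.inr ⟨_, mem_univ _, he⟩
  · intro p hp q hq hpq
    simp only [mem_insert, mem_singleton] at hp hq
    rcases hp with rfl | rfl <;> rcases hq with rfl | rfl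
    · exact absurd rfl hpq
    · exact hdis
    · exact fun x hx hx' => hdis x hx' hx
    · exact absurd rfl hpq
  · refine card_pair fun heq => hPQ (congrArg Subtype.val heq)

end SimpleGraph

/-! ### Counting edges: the forest bounds the total excess degree. -/

namespace SimpleGraph

variable {V : Type*} [Fintype V]

theorem IsAcyclic.card_edgeFinset_add_card_connectedComponent_le {H : SimpleGraph V}
    (h : H.IsAcyclic) :
    Nat.card H.edgeSet + Nat.card H.ConnectedComponent ≤ Fintype.card V := by
  classical
  induction hn : Nat.card H.edgeSet using Nat.strong_induction_on generalizing H with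
  | _ n ih =>
  subst hn
  rcases H.edgeSet.eq_empty_or_nonempty with he | ⟨e, he⟩
  · rw [he, Nat.card_coe_set_eq, Set.ncard_empty, zero_add, ← Nat.card_eq_fintype_card]
    exact Nat.card_le_card_of_surjective _ (fun c => c.exists_rep)
  · induction e using Sym2.ind with
    | _ x y =>
    rw [mem_edgeSet] at he
    have hle : H.deleteEdges {s(x, y)} ≤ H := deleteEdges_le _
    have hcard : Nat.card (H.deleteEdges {s(x, y)}).edgeSet + 1 = Nat.card H.edgeSet := by
      rw [edgeSet_deleteEdges, Nat.card_coe_set_eq, Nat.card_coe_set_eq]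
      exact Set.ncard_sdiff_singleton_add_one he
    have hcomp : Nat.card H.ConnectedComponent <
        Nat.card (H.deleteEdges {s(x, y)}).ConnectedComponent := by
      rw [Nat.card_eq_fintype_card, Nat.card_eq_fintype_card]
      refine Fintype.card_lt_of_surjective_not_injective _
        (ConnectedComponent.surjective_map_ofLE hle) ?_
      intro hinj
      have hb := isAcyclic_iff_forall_adj_isBridge.1 h he
      rw [isBridge_iff] at hb
      refine hb (ConnectedComponent.exact (hinj ?_))
      exact ConnectedComponent.sound he.reachable
    have := ih _ (by omega) (h.anti hle) rfl
    omega

variable {G : SimpleGraph V} [DecidableRel G.Adj]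

variable (G) in
/-- The vertices of degree at least three. -/
def branchVertices : Finset V := {v | 3 ≤ G.degree v}

open Classical in
variable (G) in
/-- The components of the branch graph that contain a vertex of degree at least three. -/
noncomputable def branchComponents : Finset G.branchGraph.ConnectedComponent :=
  G.branchVertices.image G.branchGraph.connectedComponentMk

theorem eq_of_branchGraph_reachable {u v : V} (hu : u ∉ G.branchVertices)
    (h : G.branchGraph.Reachable u v) : u = v := by
  obtain ⟨w⟩ := h
  cases w with
  | nil => rfl
  | cons h _ => exact absurd (by simpa [branchVertices] using h.2.1) hu

theorem card_branchComponents_le : #G.branchComponents ≤ #G.branchVertices := by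
  classical exact card_image_le

theorem branchVertices_eq_empty (h : #G.branchComponents = 0) : G.branchVertices = ∅ := by
  classical
  rwa [branchComponents, card_eq_zero, image_eq_empty] at h

variable [DecidableEq V]

/-- Each vertex of degree at most two is isolated in the branch graph, hence a component by itself.
-/
theorem card_branchComponents_add_card_compl_le :
    #G.branchComponents + #G.branchVerticesᶜ ≤ Nat.card G.branchGraph.ConnectedComponent := by
  classical
  rw [Nat.card_eq_fintype_card]
  have hA : #(G.branchVerticesᶜ.image G.branchGraph.connectedComponentMk) =
      #G.branchVerticesᶜ := by
    refine card_image_of_injOn fun a ha b _ hab => ?_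
    exact eq_of_branchGraph_reachable (by simpa using ha) (ConnectedComponent.exact hab)
  rw [← hA, ← card_union_of_disjoint]
  · exact card_le_univ _
  · rw [Finset.disjoint_left]
    intro T hT hT'
    obtain ⟨v, hv, rfl⟩ := mem_image.1 hT
    obtain ⟨w, hw, hwv⟩ := mem_image.1 hT'
    rw [mem_compl] at hw
    exact hw (eq_of_branchGraph_reachable hw (ConnectedComponent.exact hwv) ▸ hv)

theorem card_edgeFinset_le_branchGraph :
    #G.edgeFinset ≤ Nat.card G.branchGraph.edgeSet + 2 * #G.branchVerticesᶜ := by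
  classical
  have hsub : G.edgeFinset ⊆ G.branchGraph.edgeFinset ∪
      G.branchVerticesᶜ.biUnion fun v => G.incidenceFinset v := by
    intro e he
    induction e using Sym2.ind with
    | _ x y =>
    rw [mem_edgeFinset, mem_edgeSet] at he
    simp only [mem_union, mem_edgeFinset, mem_edgeSet, mem_biUnion, mem_compl,
      mem_incidenceFinset, mk'_mem_incidenceSet_iff]
    by_cases hx : x ∈ G.branchVertices
    · by_cases hy : y ∈ G.branchVertices
      · exact Or.inl ⟨he, by simpa [branchVertices] using hx, by simpa [branchVertices] using hy⟩
      · exact Or.inr ⟨y, hy, he, Or.inr rfl⟩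
    · exact Or.inr ⟨x, hx, he, Or.inl rfl⟩
  refine (card_le_card hsub).trans ((card_union_le _ _).trans ?_)
  have h1 : #G.branchGraph.edgeFinset = Nat.card G.branchGraph.edgeSet := by
    rw [Nat.card_eq_fintype_card, edgeFinset_card]
  have h2 : #(G.branchVerticesᶜ.biUnion fun v => G.incidenceFinset v) ≤
      #G.branchVerticesᶜ * 2 := by
    refine card_biUnion_le_card_mul _ _ _ fun v hv => ?_
    rw [card_incidenceFinset_eq_degree]
    simp only [branchVertices, mem_compl, mem_filter, mem_univ, true_and] at hv
    omega
  omega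

/-- The total excess degree is at most `2a - 2c`, where `a` is the number of vertices of degree two
and `c` the number of components induced by the remaining vertices. -/
theorem IsMinimallyConnected.sum_degree_sub_two_le (h : G.IsMinimallyConnected 2) :
    ∑ v ∈ G.branchVertices, (G.degree v - 2) + 2 * #G.branchComponents ≤
      2 * #G.branchVerticesᶜ := by
  have hdeg := h.noCutVertex.two_le_degree h.three_le_card
  have h1 := h.branchGraph_isAcyclic.card_edgeFinset_add_card_connectedComponent_le
  have h2 := card_branchComponents_add_card_compl_le (G := G)
  have h3 := card_edgeFinset_le_branchGraph (G := G)
  have h4 := G.sum_degrees_eq_twice_card_edges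
  have h5 : ∑ v, (G.degree v - 2) = ∑ v ∈ G.branchVertices, (G.degree v - 2) := by
    symm
    refine sum_subset (subset_univ _) fun v _ hv => ?_
    simp only [branchVertices, mem_filter, mem_univ, true_and] at hv
    omega
  have h6 : ∑ v, G.degree v = ∑ v, (G.degree v - 2) + 2 * Fintype.card V := by
    have : ∀ v ∈ univ, G.degree v = (G.degree v - 2) + 2 := fun v _ => by
      have := hdeg v
      omega
    rw [sum_congr rfl this, sum_add_distrib, sum_const, card_univ, smul_eq_mul, mul_comm 2]
  -- With `a` vertices of degree two, the forest has at most `n - c - a` edges, so `G` has at most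
  -- `n - c + a`. Compare with `2 |E| = X + 2n`.
  omega

end SimpleGraph

/-! ### Directed connectivity and degrees. -/

namespace Digraph

variable {V : Type*} {D : Digraph V}

theorem IsPath.exists_eq_cons_cons {u v : V} (huv : u ≠ v) {p : List V} (hp : D.IsPath u v p) :
    ∃ w t, p = u :: w :: t ∧ D.Adj u w := by
  obtain ⟨hu, hv, hc, -⟩ := hp
  match p, hu, hv, hc with
  | [a], hu, hv, _ =>
    simp only [List.head?_cons, List.getLast?_singleton, Option.some.injEq] at hu hv
    exact absurd (hu.symm.trans hv) huv
  | a :: w :: t, hu, _, hc =>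
    simp only [List.head?_cons, Option.some.injEq] at hu
    subst hu
    exact ⟨w, t, rfl, (List.isChain_cons_cons.1 hc).1⟩

theorem IsPath.eq_of_second_eq_last {u v : V} {t : List V} (hp : D.IsPath u v (u :: v :: t)) :
    t = [] := by
  obtain ⟨-, hv, -, hn⟩ := hp
  by_contra ht
  rw [List.getLast?_cons_cons, List.getLast?_cons_of_ne_nil ht] at hv
  have := List.mem_of_getLast? hv
  simp [this] at hn

/-- Disjoint paths have distinct second vertices; the one allowed coincidence, at `v`, forces both
paths to be the single arc `uv`. -/
theorem IsDisjointPathFamily.card_le [Fintype V] [DecidableRel D.Adj] {u v : V} (huv : u ≠ v)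
    {S : Finset (List V)} (hS : D.IsDisjointPathFamily u v S) : #S ≤ #{w | D.Adj u w} := by
  have h : ∀ p : S, ∃ w t, p.1 = u :: w :: t ∧ D.Adj u w := fun p =>
    (hS.1 p p.2).exists_eq_cons_cons huv
  choose f t hft hf using h
  rw [← card_attach]
  refine card_le_card_of_injOn f (fun p _ => by simpa using hf p) ?_
  rintro p - q - hpq
  by_contra hne
  have hwp : f p ∈ p.1 := by simp [hft p]
  have hwq : f p ∈ q.1 := by simp [hft q, hpq]
  have hp := hS.1 p p.2
  have hq := hS.1 q q.2
  rcases hS.2 p p.2 q q.2 (fun h => hne (Subtype.ext h)) (f p) hwp hwq with h1 | h1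
  · have := hp.2.2.2
    rw [hft p, h1] at this
    simp at this
  · have h2 := hft p
    have h3 := hft q
    rw [← hpq] at h3
    rw [h1] at h2 h3
    rw [h2] at hp
    rw [h3] at hq
    rw [hp.eq_of_second_eq_last] at h2
    rw [hq.eq_of_second_eq_last] at h3
    exact hne (Subtype.ext (h2.trans h3.symm))

theorem IsDisjointPathFamily.card_le_in [Fintype V] [DecidableRel D.Adj] {u v : V} (huv : u ≠ v)
    {S : Finset (List V)} (hS : D.IsDisjointPathFamily u v S) : #S ≤ #{w | D.Adj w v} := by
  classical
  let D' : Digraph V := ⟨fun a b => D.Adj b a⟩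
  have hinj : Function.Injective (List.reverse : List V → List V) := List.reverse_injective
  have hS' : D'.IsDisjointPathFamily v u (S.image List.reverse) := by
    refine ⟨?_, ?_⟩
    · intro p hp
      obtain ⟨q, hq, rfl⟩ := mem_image.1 hp
      obtain ⟨h1, h2, h3, h4⟩ := hS.1 q hq
      refine ⟨by simpa using h2, by simpa using h1, ?_, by simpa using h4⟩
      rw [List.isChain_reverse]
      exact h3
    · intro p hp q hq hpq x hxp hxq
      obtain ⟨p', hp', rfl⟩ := mem_image.1 hp
      obtain ⟨q', hq', rfl⟩ := mem_image.1 hq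
      rw [List.mem_reverse] at hxp hxq
      exact (hS.2 p' hp' q' hq' (fun h => hpq (by rw [h])) x hxp hxq).symm
  have := hS'.card_le huv.symm
  rw [card_image_of_injective _ hinj] at this
  refine this.trans_eq ?_
  congr!

theorem pairConnectivity_le_outDegree [Fintype V] [DecidableRel D.Adj] {u v : V} (huv : u ≠ v) :
    D.pairConnectivity u v ≤ #{w | D.Adj u w} := by
  refine csSup_le' ?_
  rintro k ⟨S, hS, rfl⟩
  exact hS.card_le huv

theorem pairConnectivity_le_inDegree [Fintype V] [DecidableRel D.Adj] {u v : V} (huv : u ≠ v) :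
    D.pairConnectivity u v ≤ #{w | D.Adj w v} := by
  refine csSup_le' ?_
  rintro k ⟨S, hS, rfl⟩
  exact hS.card_le_in huv

/-- Out-neighbours and in-neighbours of `u` are disjoint in an orientation, so out-degree plus
in-degree is at most the degree. -/
theorem IsOrientation.pairConnectivity_add_le [Fintype V] {G : SimpleGraph V}
    [DecidableRel G.Adj] (hD : D.IsOrientation G) {u v : V} (huv : u ≠ v) :
    D.pairConnectivity u v + D.pairConnectivity v u ≤ G.degree u := by
  classical
  refine (add_le_add (pairConnectivity_le_outDegree huv)
    (pairConnectivity_le_inDegree huv.symm)).trans ?_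
  rw [← card_union_of_disjoint, ← SimpleGraph.card_neighborFinset_eq_degree]
  · refine card_le_card fun w hw => ?_
    simp only [mem_union, mem_filter, mem_univ, true_and] at hw
    rw [SimpleGraph.mem_neighborFinset]
    exact hw.elim (hD.1 u w) fun h => (hD.1 w u h).symm
  · rw [Finset.disjoint_left]
    intro w h1 h2
    simp only [mem_filter, mem_univ, true_and] at h1 h2
    rcases hD.2 u w (hD.1 u w h1) with h | h
    · exact h.2 h2
    · exact h.2 h1

theorem exists_isPath_of_reflTransGen {u v : V} (h : Relation.ReflTransGen D.Adj u v) :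
    ∃ p, D.IsPath u v p := by
  induction h with
  | refl => exact ⟨[u], by simp [IsPath]⟩
  | @tail z z' _ hzz' ih =>
    obtain ⟨p, h1, h2, h3, h4⟩ := ih
    by_cases hz : z' ∈ p
    · obtain ⟨s, t, rfl⟩ := List.append_of_mem hz
      rw [List.append_cons] at h1 h3 h4
      refine ⟨s ++ [z'], ?_, by simp, h3.left_of_append, (List.nodup_append.1 h4).1⟩
      rwa [List.head?_append_of_ne_nil _ (by simp)] at h1
    · refine ⟨p ++ [z'], ?_, by simp, ?_, ?_⟩
      · rw [List.head?_append, h1]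
        rfl
      · rw [List.isChain_append]
        refine ⟨h3, by simp, ?_⟩
        intro x hx y hy
        rw [h2, Option.mem_some_iff] at hx
        simp only [List.head?_cons, Option.mem_some_iff] at hy
        exact hx ▸ hy ▸ hzz'
      · rw [List.nodup_append]
        refine ⟨h4, by simp, ?_⟩
        rintro a ha b hb rfl
        exact hz (List.mem_singleton.1 hb ▸ ha)

theorem one_le_pairConnectivity [Fintype V] {u v : V} (huv : u ≠ v)
    (h : Relation.ReflTransGen D.Adj u v) : 1 ≤ D.pairConnectivity u v := by
  classical
  obtain ⟨p, hp⟩ := exists_isPath_of_reflTransGen h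
  refine le_csSup ⟨#{w | D.Adj u w}, ?_⟩ ⟨{p}, ⟨by simpa using hp, ?_⟩, by simp⟩
  · rintro k ⟨S, hS, rfl⟩
    exact hS.card_le huv
  · intro q hq r hr hqr
    exact absurd ((mem_singleton.1 hq).trans (mem_singleton.1 hr).symm) hqr

end Digraph

/-! ### Robbins' theorem. -/

namespace SimpleGraph

variable {V : Type*} [Fintype V] {G : SimpleGraph V}

theorem NoCutVertex.exists_adj_ne (h : G.NoCutVertex) (hcard : 3 ≤ Fintype.card V)
    (A : Set V) {a b : V} (ha : a ∈ A) (hb : b ∉ A) (e : V × V) :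
    ∃ p q, p ∈ A ∧ q ∉ A ∧ G.Adj p q ∧ (p, q) ≠ e := by
  classical
  have h2 := h.two_le_edgeBoundaryCard hcard (C := A.toFinset) (a := a) (b := b) (by simpa)
    (by simpa)
  rw [edgeBoundaryCard] at h2
  obtain ⟨⟨p, q⟩, hpq, hne⟩ := exists_mem_ne (by exact h2) e
  simp only [mem_filter, mem_product, mem_compl, Set.mem_toFinset] at hpq
  exact ⟨p, q, hpq.1.1, hpq.1.2, hpq.2, hne⟩

theorem NoCutVertex.reflTransGen (h : G.NoCutVertex) (hcard : 3 ≤ Fintype.card V) (u v : V) :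
    Relation.ReflTransGen G.Adj u v := by
  by_contra hcon
  obtain ⟨p, q, hp, hq, hpq, -⟩ := h.exists_adj_ne hcard {z | Relation.ReflTransGen G.Adj u z}
    (a := u) Relation.ReflTransGen.refl hcon (u, u)
  exact hq (Relation.ReflTransGen.tail hp hpq)

/-- If `R` is a strongly connected relation on the vertices of `G` covering all edges, and both
`R u v` and `R v u` hold, then one of these two arcs can be removed keeping `R` strong. -/
theorem NoCutVertex.exists_removable_arc (h : G.NoCutVertex) (hcard : 3 ≤ Fintype.card V)
    {R : V → V → Prop} (hG : ∀ u v, G.Adj u v → R u v ∨ R v u)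
    (hR : ∀ u v, Relation.ReflTransGen R u v) {u v : V}
    (h1 : ¬ Relation.ReflTransGen (fun a b => R a b ∧ (a, b) ≠ (u, v)) u v) :
    Relation.ReflTransGen (fun a b => R a b ∧ (a, b) ≠ (v, u)) v u := by
  -- Let `U` be the set reachable from `u` without the arc `uv`. A second edge `pq` leaves `U` and
  -- must be directed inwards, which yields the route from `v` to `q`, across to `p`, and on to `u`
  -- inside `U`, never using the arc `vu`.
  obtain ⟨p, q, hp, hq, hpq, hne⟩ := h.exists_adj_ne hcard
    {z | Relation.ReflTransGen (fun a b => R a b ∧ (a, b) ≠ (u, v)) u z}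
    (a := u) Relation.ReflTransGen.refl h1 (u, v)
  have hRqp : R q p := by
    refine (hG p q hpq).resolve_left fun hRpq => hq ?_
    exact Relation.ReflTransGen.tail hp ⟨hRpq, hne⟩
  have hvq : ∀ z, Relation.ReflTransGen R u z →
      Relation.ReflTransGen (fun a b => R a b ∧ (a, b) ≠ (u, v)) u z ∨
      Relation.ReflTransGen (fun a b => R a b ∧ (a, b) ≠ (v, u)) v z := by
    intro z hz
    induction hz with
    | refl => exact Or.inl Relation.ReflTransGen.refl
    | @tail z z' _ hzz' ih =>
      rcases ih with ih | ih
      · by_cases he : (z, z') = (u, v)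
        · rw [Prod.mk.injEq] at he
          exact Or.inr (he.2 ▸ Relation.ReflTransGen.refl)
        · exact Or.inl (ih.tail ⟨hzz', he⟩)
      · by_cases he : (z, z') = (v, u)
        · rw [Prod.mk.injEq] at he
          exact Or.inl (he.2 ▸ Relation.ReflTransGen.refl)
        · exact Or.inr (ih.tail ⟨hzz', he⟩)
  have hpu : ∀ z, Relation.ReflTransGen R z u →
      Relation.ReflTransGen (fun a b => R a b ∧ (a, b) ≠ (u, v)) u z →
      Relation.ReflTransGen (fun a b => R a b ∧ (a, b) ≠ (v, u)) z u := by
    intro z hz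
    induction hz using Relation.ReflTransGen.head_induction_on with
    | refl => exact fun _ => Relation.ReflTransGen.refl
    | @head z z' hzz' _ ih =>
      intro hz
      by_cases hzu : z = u
      · exact hzu ▸ Relation.ReflTransGen.refl
      · refine Relation.ReflTransGen.head ⟨hzz', ?_⟩ (ih (hz.tail ⟨hzz', ?_⟩))
        · rintro he
          rw [Prod.mk.injEq] at he
          exact h1 (he.1 ▸ hz)
        · rintro he
          rw [Prod.mk.injEq] at he
          exact hzu he.1
  refine (((hvq q (hR u q)).resolve_left hq).tail ⟨hRqp, ?_⟩).trans (hpu p (hR p u) hp)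
  intro he
  rw [Prod.mk.injEq] at he
  exact hne (by rw [he.1, he.2])

/-- Robbins' theorem for graphs without cut vertices. -/
theorem NoCutVertex.exists_strong_orientation (h : G.NoCutVertex)
    (hcard : 3 ≤ Fintype.card V) :
    ∃ D : Digraph V, D.IsOrientation G ∧ ∀ u v, Relation.ReflTransGen D.Adj u v := by
  classical
  -- A minimal strong set of arcs covering every edge, below the one with both directions
  -- everywhere, contains no opposite pair and so is an orientation.
  let s : Set (Set (V × V)) := {A | (∀ u v, (u, v) ∈ A → G.Adj u v) ∧
    (∀ u v, G.Adj u v → (u, v) ∈ A ∨ (v, u) ∈ A) ∧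
    ∀ u v, Relation.ReflTransGen (fun a b => (a, b) ∈ A) u v}
  have hs : s.Nonempty := ⟨{e | G.Adj e.1 e.2}, fun _ _ h => h, fun _ _ h => Or.inl h,
    fun u v => h.reflTransGen hcard u v⟩
  obtain ⟨A, ⟨hA1, hA2, hA3⟩, hmin⟩ := (Set.toFinite s).exists_minimal hs
  have hrem : ∀ u v, (u, v) ∈ A → (v, u) ∈ A →
      ¬ Relation.ReflTransGen (fun a b => (a, b) ∈ A ∧ (a, b) ≠ (u, v)) u v := by
    intro u v huv hvu hr
    have hmem : A \ {(u, v)} ∈ s := by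
      refine ⟨fun a b hab => hA1 a b hab.1, ?_, ?_⟩
      · intro a b hab
        by_cases hab' : (a, b) = (u, v)
        · rw [Prod.mk.injEq] at hab'
          obtain ⟨rfl, rfl⟩ := hab'
          refine Or.inr ⟨hvu, fun he => ?_⟩
          rw [Set.mem_singleton_iff, Prod.mk.injEq] at he
          exact hab.ne he.2
        · by_cases hba' : (b, a) = (u, v)
          · rw [Prod.mk.injEq] at hba'
            obtain ⟨rfl, rfl⟩ := hba'
            exact Or.inl ⟨hvu, hab'⟩
          · exact (hA2 a b hab).imp (fun h => ⟨h, hab'⟩) fun h => ⟨h, hba'⟩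
      · intro a b
        induction hA3 a b with
        | refl => exact Relation.ReflTransGen.refl
        | @tail c d _ hcd ih =>
          by_cases hcd' : (c, d) = (u, v)
          · rw [Prod.mk.injEq] at hcd'
            obtain ⟨rfl, rfl⟩ := hcd'
            exact ih.trans hr
          · exact ih.tail ⟨hcd, hcd'⟩
    exact (hmin hmem Set.sdiff_subset huv).2 rfl
  refine ⟨⟨fun a b => (a, b) ∈ A⟩, ⟨hA1, fun u v huv => ?_⟩, hA3⟩
  have hnot : ¬ ((u, v) ∈ A ∧ (v, u) ∈ A) := fun ⟨h1, h2⟩ =>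
    hrem v u h2 h1 (h.exists_removable_arc hcard hA2 hA3 (hrem u v h1 h2))
  rcases hA2 u v huv with h1 | h1
  · exact Or.inl ⟨h1, fun h2 => hnot ⟨h1, h2⟩⟩
  · exact Or.inr ⟨h1, fun h2 => hnot ⟨h2, h1⟩⟩

end SimpleGraph

/-! ### Summing over pairs, and the final estimates. -/

namespace SimpleGraph

variable {V : Type*} [Fintype V]

theorem card_offDiag_univ :
    (#(univ : Finset V).offDiag : ℝ) = (Fintype.card V : ℝ) * ((Fintype.card V : ℝ) - 1) := by
  rw [offDiag_card, card_univ, Nat.cast_sub (Nat.le_mul_self _)]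
  push_cast
  ring

theorem card_mul_card_sub_one_pos (h : 3 ≤ Fintype.card V) :
    0 < (Fintype.card V : ℝ) * ((Fintype.card V : ℝ) - 1) := by
  have : (3 : ℝ) ≤ Fintype.card V := by exact_mod_cast h
  exact mul_pos (by linarith) (by linarith)

variable [DecidableEq V] {G : SimpleGraph V}

theorem sum_offDiag_eq_two_mul_sum_sym2 (f : V → V → ℕ) (hf : ∀ u v, f u v = f v u) :
    ∑ e ∈ (univ : Finset V).offDiag, f e.1 e.2 =
      2 * ∑ e : Sym2 V with ¬ e.IsDiag, Sym2.lift ⟨f, hf⟩ e := by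
  rw [mul_sum, ← sum_fiberwise_of_maps_to (g := fun e : V × V => s(e.1, e.2))
    (t := {e : Sym2 V | ¬ e.IsDiag})]
  · refine sum_congr rfl fun e he => ?_
    induction e using Sym2.ind with
    | _ a b =>
    have hab : a ≠ b := by simpa using he
    have hset : ({e ∈ (univ : Finset V).offDiag | s(e.1, e.2) = s(a, b)} : Finset (V × V)) =
        {(a, b), (b, a)} := by
      ext ⟨p, q⟩
      simp only [mem_filter, mem_offDiag, mem_univ, true_and, Sym2.eq_iff, mem_insert,
        mem_singleton, Prod.mk.injEq]
      constructor
      · exact fun h => h.2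
      · rintro (⟨rfl, rfl⟩ | ⟨rfl, rfl⟩)
        · exact ⟨hab, Or.inl ⟨rfl, rfl⟩⟩
        · exact ⟨hab.symm, Or.inr ⟨rfl, rfl⟩⟩
    rw [hset, sum_pair (by simp [hab]), Sym2.lift_mk]
    change f a b + f b a = 2 * f a b
    rw [hf b a, two_mul]
  · intro e he
    simpa using he

theorem averageConnectivity_eq :
    G.averageConnectivity =
      ((∑ e ∈ (univ : Finset V).offDiag, G.pairConnectivity e.1 e.2 : ℕ) : ℝ) /
        ((Fintype.card V : ℝ) * ((Fintype.card V : ℝ) - 1)) := by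
  rw [averageConnectivity, sum_offDiag_eq_two_mul_sum_sym2 _ G.pairConnectivity_comm,
    Nat.cast_choose_two, ← Nat.cast_sum, Nat.cast_mul, div_div_eq_mul_div, mul_comm,
    Nat.cast_ofNat]

theorem sum_offDiag_univ (f : V → V → ℕ) :
    ∑ e ∈ (univ : Finset V).offDiag, f e.1 e.2 = ∑ u, ∑ v ∈ univ.erase u, f u v := by
  rw [sum_sigma']
  refine sum_bij' (fun e _ => ⟨e.1, e.2⟩) (fun e _ => (e.1, e.2)) ?_ ?_ ?_ ?_ ?_ <;>
    simp +contextual [eq_comm]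

theorem IsMinimallyConnected.two_le_averageConnectivity (h : G.IsMinimallyConnected 2) :
    2 ≤ G.averageConnectivity := by
  rw [averageConnectivity_eq, le_div_iff₀ (card_mul_card_sub_one_pos h.three_le_card),
    ← card_offDiag_univ]
  have : #(univ : Finset V).offDiag * 2 ≤
      ∑ e ∈ (univ : Finset V).offDiag, G.pairConnectivity e.1 e.2 := by
    rw [← smul_eq_mul]
    refine card_nsmul_le_sum _ _ _ fun e he => ?_
    have hne := (mem_offDiag.1 he).2.2
    exact (h.noCutVertex.hasTwoPaths h.three_le_card hne).two_le_pairConnectivity hne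
  rw [mul_comm]
  exact_mod_cast this

theorem IsMinimallyConnected.one_le_maxAverageConnectivity (h : G.IsMinimallyConnected 2) :
    1 ≤ G.maxAverageConnectivity := by
  obtain ⟨D, hD, hstrong⟩ := h.noCutVertex.exists_strong_orientation h.three_le_card
  refine le_trans ?_ (G.isGreatest_maxAverageConnectivity.2 ⟨D, hD, rfl⟩)
  rw [Digraph.averageConnectivity, le_div_iff₀ (card_mul_card_sub_one_pos h.three_le_card),
    ← card_offDiag_univ, ← Nat.cast_sum, one_mul]
  have : #(univ : Finset V).offDiag • 1 ≤
      ∑ e ∈ (univ : Finset V).offDiag, D.pairConnectivity e.1 e.2 :=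
    card_nsmul_le_sum _ _ _ fun e he =>
      Digraph.one_le_pairConnectivity (mem_offDiag.1 he).2.2 (hstrong _ _)
  rw [smul_eq_mul, mul_one] at this
  exact_mod_cast this

section Excess

variable [DecidableRel G.Adj]

/-- The component of `u` contributes nothing and each other component at most `deg u - 2`. Adding
`deg u - 2` on the left avoids subtracting one from the number of components. -/
theorem IsMinimallyConnected.sum_excess_add_le (h : G.IsMinimallyConnected 2) {u : V}
    (hu : u ∈ G.branchVertices) :
    ∑ v ∈ univ.erase u, (G.pairConnectivity u v - 2) + (G.degree u - 2) ≤
      #G.branchComponents * (G.degree u - 2) := by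
  classical
  have hmem : G.branchGraph.connectedComponentMk u ∈ G.branchComponents :=
    mem_image_of_mem _ hu
  have h1 : ∑ v ∈ univ.erase u, (G.pairConnectivity u v - 2) =
      ∑ v ∈ G.branchVertices.erase u, (G.pairConnectivity u v - 2) := by
    symm
    refine sum_subset (erase_subset_erase _ (subset_univ _)) fun v hv hv' => ?_
    have hvu := ne_of_mem_erase hv
    have hv3 : ¬ 3 ≤ G.degree v := fun h3 => hv' (by simp [hvu, branchVertices, h3])
    have := G.pairConnectivity_le_degree hvu
    rw [pairConnectivity_comm] at this
    omega
  have h2 : ∑ v ∈ G.branchVertices.erase u, (G.pairConnectivity u v - 2) =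
      ∑ T ∈ G.branchComponents, ∑ v ∈ G.branchVertices.erase u with
        G.branchGraph.connectedComponentMk v = T, (G.pairConnectivity u v - 2) :=
    (sum_fiberwise_of_maps_to (fun v hv => mem_image_of_mem _ (mem_of_mem_erase hv)) _).symm
  rw [h1, h2, ← sum_erase_add _ _ hmem, ← card_erase_add_one hmem, add_mul, one_mul]
  have h3 : ∑ v ∈ G.branchVertices.erase u with G.branchGraph.connectedComponentMk v =
      G.branchGraph.connectedComponentMk u, (G.pairConnectivity u v - 2) = 0 := by
    refine sum_eq_zero fun v hv => ?_
    rw [mem_filter, mem_erase] at hv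
    have := h.pairConnectivity_le_two_of_reachable hv.1.1.symm
      (ConnectedComponent.exact hv.2).symm
    omega
  rw [h3, add_zero]
  refine Nat.add_le_add_right ?_ _
  refine sum_le_card_nsmul _ _ _ fun T hT => ?_
  obtain ⟨hTu, hT⟩ := mem_erase.1 hT
  obtain ⟨v₀, -, rfl⟩ := mem_image.1 hT
  refine Nat.le_sub_of_add_le (h.sum_component_add_two_le_degree (v₀ := v₀) ?_ ?_)
  · exact fun hr => hTu (ConnectedComponent.sound hr)
  · intro v hv
    exact (ConnectedComponent.exact (mem_filter.1 hv).2).symm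

theorem IsMinimallyConnected.sum_pairConnectivity_add_le (h : G.IsMinimallyConnected 2) :
    ∑ e ∈ (univ : Finset V).offDiag, G.pairConnectivity e.1 e.2 +
        ∑ v ∈ G.branchVertices, (G.degree v - 2) ≤
      2 * #(univ : Finset V).offDiag +
        #G.branchComponents * ∑ v ∈ G.branchVertices, (G.degree v - 2) := by
  have h1 : ∑ e ∈ (univ : Finset V).offDiag, G.pairConnectivity e.1 e.2 ≤
      ∑ e ∈ (univ : Finset V).offDiag, (2 + (G.pairConnectivity e.1 e.2 - 2)) :=
    sum_le_sum fun e _ => by omega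
  rw [sum_add_distrib, sum_const, smul_eq_mul, mul_comm,
    sum_offDiag_univ fun u v => G.pairConnectivity u v - 2] at h1
  have h2 : ∑ u, ∑ v ∈ univ.erase u, (G.pairConnectivity u v - 2) =
      ∑ u ∈ G.branchVertices, ∑ v ∈ univ.erase u, (G.pairConnectivity u v - 2) := by
    symm
    refine sum_subset (subset_univ _) fun u _ hu => sum_eq_zero fun v hv => ?_
    have hu3 : ¬ 3 ≤ G.degree u := fun h3 => hu (by simp [branchVertices, h3])
    have := G.pairConnectivity_le_degree (ne_of_mem_erase hv).symm
    omega
  have h3 := sum_le_sum fun u hu => h.sum_excess_add_le (u := u) hu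
  rw [sum_add_distrib, ← mul_sum] at h3
  omega

theorem sum_orientation_add_le {D : Digraph V} (hD : D.IsOrientation G) :
    2 * ∑ e ∈ (univ : Finset V).offDiag, D.pairConnectivity e.1 e.2 +
        ∑ v ∈ G.branchVertices, (G.degree v - 2) ≤
      2 * #(univ : Finset V).offDiag +
        #G.branchVertices * ∑ v ∈ G.branchVertices, (G.degree v - 2) := by
  have hswap : ∑ e ∈ (univ : Finset V).offDiag, D.pairConnectivity e.1 e.2 =
      ∑ e ∈ (univ : Finset V).offDiag, D.pairConnectivity e.2 e.1 := by
    refine sum_bij' (fun e _ => e.swap) (fun e _ => e.swap) ?_ ?_ ?_ ?_ ?_ <;>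
      simp +contextual [eq_comm]
  -- The degree bound at `u` is used when `v` has degree at least three; otherwise the degree of `v`
  -- already bounds the sum by two.
  let f : V → V → ℕ := fun u v => if v ∈ G.branchVertices then G.degree u - 2 else 0
  have h1 : ∑ e ∈ (univ : Finset V).offDiag,
      (D.pairConnectivity e.1 e.2 + D.pairConnectivity e.2 e.1) ≤
      ∑ e ∈ (univ : Finset V).offDiag, (2 + f e.1 e.2) := by
    refine sum_le_sum fun e he => ?_
    have hne := (mem_offDiag.1 he).2.2
    have h2 := hD.pairConnectivity_add_le hne
    have h3 := hD.pairConnectivity_add_le hne.symm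
    by_cases hv : e.2 ∈ G.branchVertices
    · simp only [f, hv, if_true]
      omega
    · simp only [f, hv, if_false]
      have : ¬ 3 ≤ G.degree e.2 := fun h3 => hv (by simp [branchVertices, h3])
      omega
  rw [sum_add_distrib, ← hswap, sum_add_distrib, sum_const, smul_eq_mul, sum_offDiag_univ f] at h1
  have h2 : ∑ u, ∑ v ∈ univ.erase u, f u v =
      ∑ u ∈ G.branchVertices, ∑ v ∈ univ.erase u, f u v := by
    symm
    refine sum_subset (subset_univ _) fun u _ hu => sum_eq_zero fun v _ => ?_
    have hu3 : ¬ 3 ≤ G.degree u := fun h3 => hu (by simp [branchVertices, h3])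
    have : G.degree u - 2 = 0 := by omega
    simp [f, this]
  have h3 : ∑ u ∈ G.branchVertices, (∑ v ∈ univ.erase u, f u v + (G.degree u - 2)) =
      ∑ u ∈ G.branchVertices, #G.branchVertices * (G.degree u - 2) := by
    refine sum_congr rfl fun u hu => ?_
    have hfu : f u u = G.degree u - 2 := by simp [f, hu]
    rw [← hfu, sum_erase_add _ _ (mem_univ u), hfu]
    simp [f, sum_ite_mem]
  rw [sum_add_distrib, ← mul_sum] at h3
  omega

theorem IsMinimallyConnected.averageConnectivity_lt (h : G.IsMinimallyConnected 2) :
    G.averageConnectivity < 9 / 4 := by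
  have hpos := card_mul_card_sub_one_pos h.three_le_card
  have h1 := h.sum_pairConnectivity_add_le
  have h2 := h.sum_degree_sub_two_le
  have h3 : #G.branchComponents ≤ #G.branchVertices := card_branchComponents_le
  have h4 := card_add_card_compl G.branchVertices
  have hn := h.three_le_card
  rw [averageConnectivity_eq, div_lt_iff₀ hpos]
  rcases Nat.eq_zero_or_pos #G.branchComponents with h0 | hc
  · rw [h0, zero_mul, add_zero] at h1
    have h1' := (Nat.le_add_right _ _).trans h1
    rify at h1'
    rw [card_offDiag_univ] at h1'
    push_cast
    linarith
  · rify at h1 h2 h3 h4 hn hc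
    rw [card_offDiag_univ] at h1
    push_cast
    have hc1 : (1 : ℝ) ≤ #G.branchComponents := by exact_mod_cast hc
    generalize (∑ v ∈ G.branchVertices, ((G.degree v - 2 : ℕ) : ℝ)) = X at *
    -- With `m = c - 1`, the product gives `mX ≤ m(2(n - 2) - 4m) = ((n - 2)² - (n - 2 - 4m)²) / 4`.
    nlinarith [mul_nonneg (sub_nonneg.2 hc1)
      (show (0 : ℝ) ≤ 2 * Fintype.card V - 4 * #G.branchComponents - X by linarith),
      sq_nonneg ((Fintype.card V : ℝ) - 2 - 4 * (#G.branchComponents - 1))]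

theorem IsMinimallyConnected.orientation_averageConnectivity_lt (h : G.IsMinimallyConnected 2)
    {D : Digraph V} (hD : D.IsOrientation G) : D.averageConnectivity < 5 / 4 := by
  have hpos := card_mul_card_sub_one_pos h.three_le_card
  have h1 := sum_orientation_add_le hD
  have h2 := h.sum_degree_sub_two_le
  have h4 := card_add_card_compl G.branchVertices
  have hn := h.three_le_card
  rw [Digraph.averageConnectivity, div_lt_iff₀ hpos]
  rcases Nat.eq_zero_or_pos #G.branchComponents with h0 | hc
  · rw [branchVertices_eq_empty h0, card_empty, zero_mul, add_zero, sum_empty, add_zero] at h1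
    rify at h1
    rw [card_offDiag_univ] at h1
    linarith
  · have hf : 1 ≤ #G.branchVertices := hc.trans_le card_branchComponents_le
    rify at h1 h2 h4 hn hc hf
    rw [card_offDiag_univ] at h1
    have hc1 : (1 : ℝ) ≤ #G.branchComponents := by exact_mod_cast hc
    generalize (∑ v ∈ G.branchVertices, ((G.degree v - 2 : ℕ) : ℝ)) = X at *
    -- With `m = b - 1`, the product gives `mX ≤ m(2(n - 2) - 2m) = ((n - 2)² - (n - 2 - 2m)²) / 2`;
    -- only `c ≥ 1` is used here.
    nlinarith [mul_nonneg (sub_nonneg.2 hf)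
      (show (0 : ℝ) ≤ 2 * (Fintype.card V - #G.branchVertices) - 2 - X by linarith),
      sq_nonneg ((Fintype.card V : ℝ) - 2 - 2 * (#G.branchVertices - 1))]

theorem IsMinimallyConnected.maxAverageConnectivity_lt (h : G.IsMinimallyConnected 2) :
    G.maxAverageConnectivity < 5 / 4 := by
  obtain ⟨D, hD, hDeq⟩ := G.isGreatest_maxAverageConnectivity.1
  exact hDeq ▸ h.orientation_averageConnectivity_lt hD

end Excess

end SimpleGraph

theorem corollary4p7 {V : Type*} [Fintype V] [DecidableEq V] (G : SimpleGraph V)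
    (hG : G.IsMinimallyConnected 2) :
    4 / 9 < G.maxAverageConnectivity / G.averageConnectivity ∧
      G.maxAverageConnectivity / G.averageConnectivity < 5 / 8 := by
  classical
  have h1 := hG.two_le_averageConnectivity
  have h2 := hG.averageConnectivity_lt
  have h3 := hG.one_le_maxAverageConnectivity
  have h4 := hG.maxAverageConnectivity_lt
  have hpos : 0 < G.averageConnectivity := by linarith
  rw [lt_div_iff₀ hpos, div_lt_iff₀ hpos]
  constructor <;> linarith
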